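/- Let $\mathsf{PId}$, $\mathbb M$, $\mathbb D$ be countably infinite sets of site names, methods and data values. An \emph{execution} is a finite word over $\mathsf{PId}\times\mathbb M\times\mathbb D\times\mathbb D$, a letter $(p,m,\mathit{arg},\mathit{rv})$ standing for a call of $m$ with argument $\mathit{arg}$ on site $p$ that returns $\mathit{rv}$. An \emph{implementation} is a prefix-closed set of executions, and a \emph{specification} is a set of finite words over $\mathbb M\times\mathbb D\times\mathbb D$. The \emph{history} of an execution $e$ is $(O,\mathsf{PO},\ell)$, where $O$ is the set of positions of $e$, $\ell(o)=(m,\mathit{arg},\mathit{rv})$ is the label of $o$ without its site, and $o_1<_{\mathsf{PO}}o_2$ iff $o_1,o_2$ are on the same site and $o_1$ occurs before $o_2$ in $e$. For a strict partial order $r$ on $O$ and sets $A,K\subseteq O$, say that $(A,r,K)$ is \emph{explained} by $S$ if there is an enumeration of $A$ without repetition that respects $r$ and a word of $S$ of the same length such that, at each position, the letter of the word has the same method and argument as $\ell(o)$ for the operation $o$ enumerated there, and also the same return value if $o\in K$. For a relation $\mathit{co}$ on $O$ put $\mathrm{CausalPast}(o)=\{o' : o'<_{\mathit{co}}o \text{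 or } o'=o\}$ and $\mathrm{POPast}(o)=\{o' : o'<_{\mathsf{PO}}o\text{ or }o'=o\}$. With respect to $S$, the history (and the execution) is - CC (causally consistent) if there is a strict partial order $\mathit{co}\supseteq\mathsf{PO}$ such that $(\mathrm{CausalPast}(o),\mathit{co},\{o\})$ is explained by $S$ for every $o\in O$; - CM (causal memory) if there is a strict partial order $\mathit{co}\supseteq\mathsf{PO}$ such that $(\mathrm{CausalPast}(o),\mathit{co},\mathrm{POPast}(o))$ is explained by $S$ for every $o\in O$; - CCv (causally convergent) if there are a strict partial order $\mathit{co}\supseteq\mathsf{PO}$ and a strict total order $\mathit{arb}\supseteq\mathit{co}$ such that $(\mathrm{CausalPast}(o),\mathit{arb},\{o\})$ is explained by $S$ for every $o\in O$. **Theorem.** For each criterion $C\in\{\mathrm{CC},\mathrm{CM},\mathrm{CCv}\}$ the following problem is undecidable: given an implementation $\mathcal I$ and a specification $S$ that are regular languages (over finite alphabets, given by nondeterministic finite automata), do all executions of $\mathcal I$ satisfy $C$ with respect to $S$? It is undecidable even for implementations whose executions use only two fixed sites. (Undecidable means that no algorithm halts with the right answer on all such inputs.) -/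

import Mathlib

/-! ## Labeled posets -/

/-- A strict partial order. -/
def IsStrictPO {O : Type} (r : O → O → Prop) : Prop :=
  (∀ a, ¬ r a a) ∧ ∀ a b c, r a b → r b c → r a c

/-- A strict total order. -/
def IsStrictTO {O : Type} (r : O → O → Prop) : Prop :=
  IsStrictPO r ∧ ∀ a b, a ≠ b → r a b ∨ r b a

/-- A `Λ`-labeled poset with underlying set `O`. -/
structure LPoset (O Λ : Type) where
  lt : O → O → Prop
  label : O → Λ
  isStrictPO : IsStrictPO lt

/-- The label of an operation: method, argument, return value. -/
abbrev OpLabel (M D : Type) : Type := M × D × D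

/-- An operation label whose return value may be missing: `(m, arg, none)` is the label `(m, arg)`,
and `(m, arg, some rv)` is the label `(m, arg, rv)`. -/
abbrev PartialLabel (M D : Type) : Type := M × D × Option D

namespace LPoset

/-- The labeled poset in which only the return values of the operations in `K` are kept. -/
noncomputable def keepReturns {O M D : Type} (ρ : LPoset O (OpLabel M D)) (K : Set O) :
    LPoset O (PartialLabel M D) where
  lt := ρ.lt
  label := by
    classical
    exact fun o =>
      if o ∈ K then ((ρ.label o).1, (ρ.label o).2.1, some (ρ.label o).2.2)
      else ((ρ.label o).1, (ρ.label o).2.1, none)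
  isStrictPO := ρ.isStrictPO

/-- A fully labeled poset seen as one labeled by partial labels. -/
def full {O M D : Type} (ρ : LPoset O (OpLabel M D)) : LPoset O (PartialLabel M D) where
  lt := ρ.lt
  label o := ((ρ.label o).1, (ρ.label o).2.1, some (ρ.label o).2.2)
  isStrictPO := ρ.isStrictPO

/-- The relation `ρ₁ ⪯ ρ₂`: on the same set of operations, `ρ₁` has fewer order constraints, and
each label of `ρ₁` is that of `ρ₂`, possibly with the return value missing. -/
def Weaker {O M D : Type} (ρ₁ ρ₂ : LPoset O (PartialLabel M D)) : Prop :=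
  (∀ a b, ρ₁.lt a b → ρ₂.lt a b) ∧
  ∀ o, ρ₂.label o = ρ₁.label o ∨
    ∃ m arg rv, ρ₂.label o = (m, arg, some rv) ∧ ρ₁.label o = (m, arg, none)

/-- `ρ` is a (finite) sequence, and its labels, read in increasing order, form the word `w`. -/
def IsSequence {O Λ : Type} (ρ : LPoset O Λ) (w : List Λ) : Prop :=
  ∃ e : Fin w.length ≃ O,
    (∀ i j, ρ.lt (e i) (e j) ↔ i < j) ∧ ∀ i, ρ.label (e i) = w.get i

end LPoset

/-! ## Histories and specifications -/

/-- A history: operations labeled by methods, arguments and return values, and a program order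
that is a union of total orders, one for each site. -/
structure History (M D : Type) where
  Op : Type
  po : Op → Op → Prop
  label : Op → OpLabel M D
  po_strict : IsStrictPO po
  po_sites : ∃ (P : Type) (site : Op → P),
    (∀ a b, po a b → site a = site b) ∧
    ∀ a b, site a = site b → a ≠ b → po a b ∨ po b a

/-- A specification: a set of finite sequences of labeled operations. -/
abbrev Spec (M D : Type) : Type := Language (OpLabel M D)

/-- The labeled sequential poset `ρ` belongs to the specification `S`. -/
def Spec.Contains {O M D : Type} (S : Spec M D) (ρ : LPoset O (OpLabel M D)) : Prop :=
  ∃ w ∈ S, ρ.IsSequence w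

namespace History

variable {M D : Type}

/-- The causal past of `o`: the operations that are equal to `o` or before `o` in `co`. -/
def causalPast (h : History M D) (co : h.Op → h.Op → Prop) (o : h.Op) : Set h.Op :=
  {x | co x o ∨ x = o}

/-- The operations that are equal to `o` or before `o` in program order. -/
def poPast (h : History M D) (o : h.Op) : Set h.Op :=
  {x | h.po x o ∨ x = o}

/-- The restriction of the labeled poset `(O, r, ℓ)` to the set `A` of operations. -/
def restrict (h : History M D) (r : h.Op → h.Op → Prop) (hr : IsStrictPO r) (A : Set h.Op) :
    LPoset A (OpLabel M D) where
  lt a b := r a b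
  label a := h.label a
  isStrictPO := ⟨fun a => hr.1 a, fun a b c => hr.2 a b c⟩

/-- The labeled poset `(A, r, ℓ)`, in which only the return values of the operations in `K` are
kept, can be sequentialized to a sequence in `S`. -/
def Explained (h : History M D) (S : Spec M D) (r : h.Op → h.Op → Prop) (hr : IsStrictPO r)
    (A K : Set h.Op) : Prop :=
  ∃ ρ : LPoset A (OpLabel M D), S.Contains ρ ∧
    ((h.restrict r hr A).keepReturns {a | (a : h.Op) ∈ K}).Weaker ρ.full

/-- Causal consistency. -/
def IsCC (h : History M D) (S : Spec M D) : Prop :=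
  ∃ (co : h.Op → h.Op → Prop) (hco : IsStrictPO co),
    (∀ a b, h.po a b → co a b) ∧
    ∀ o, h.Explained S co hco (h.causalPast co o) {o}

/-- Causal memory. -/
def IsCM (h : History M D) (S : Spec M D) : Prop :=
  ∃ (co : h.Op → h.Op → Prop) (hco : IsStrictPO co),
    (∀ a b, h.po a b → co a b) ∧
    ∀ o, h.Explained S co hco (h.causalPast co o) (h.poPast o)

/-- Causal convergence. -/
def IsCCv (h : History M D) (S : Spec M D) : Prop :=
  ∃ (co arb : h.Op → h.Op → Prop) (_ : IsStrictPO co) (harb : IsStrictTO arb),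
    (∀ a b, h.po a b → co a b) ∧
    (∀ a b, co a b → arb a b) ∧
    ∀ o, h.Explained S arb harb.1 (h.causalPast co o) {o}

end History

/-- The three variants of causal consistency. -/
inductive Criterion where
  | CC
  | CM
  | CCv

/-- The history `h` satisfies the given criterion with respect to `S`. -/
def Criterion.Holds {M D : Type} (c : Criterion) (h : History M D) (S : Spec M D) : Prop :=
  match c with
  | .CC => h.IsCC S
  | .CM => h.IsCM S
  | .CCv => h.IsCCv S

/-! ## Executions and implementations -/

/-- The label `(site, method, argument, return value)` of an operation in an execution. -/
abbrev ExecLabel (P M D : Type) : Type := P × OpLabel M D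

/-- The history of an execution: operations are the positions of the execution, and two of them
are ordered by program order if they are on the same site, in the order of the execution. -/
def execHistory {P M D : Type} (e : List (ExecLabel P M D)) : History M D where
  Op := Fin e.length
  po i j := (e.get i).1 = (e.get j).1 ∧ i < j
  label i := (e.get i).2
  po_strict := ⟨fun _ h => lt_irrefl _ h.2,
    fun _ _ _ h₁ h₂ => ⟨h₁.1.trans h₂.1, h₁.2.trans h₂.2⟩⟩
  po_sites := ⟨P, fun i => (e.get i).1, fun _ _ h => h.1, fun _ _ h hne =>
    (lt_or_gt_of_ne hne).imp (fun hl => ⟨h, hl⟩) (fun hl => ⟨h.symm, hl⟩)⟩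

/-- An implementation is a prefix-closed set of executions. -/
def IsImplementation {P M D : Type} (I : Language (ExecLabel P M D)) : Prop :=
  ∀ e₁ e₂, e₁ ++ e₂ ∈ I → e₁ ∈ I

/-! ## Regular languages as inputs of algorithms -/

/-- A (nondeterministic) finite automaton over letters from `A`, as a finite object: the list of
initial states, the list of transitions `(q, a, r)`, and the list of accepting states. Its states
are the finitely many natural numbers that occur in these lists, and its alphabet is the finite set
of letters that occur in its transitions. -/
abbrev FinAutomaton (A : Type) : Type := List ℕ × List (ℕ × A × ℕ) × List ℕ

/-- The automaton as a Mathlib `NFA`. -/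
def FinAutomaton.toNFA {A : Type} (𝒜 : FinAutomaton A) : NFA A ℕ where
  start := {q | q ∈ 𝒜.1}
  step q a := {r | (q, a, r) ∈ 𝒜.2.1}
  accept := {q | q ∈ 𝒜.2.2}

/-- The regular language accepted by the automaton. -/
def FinAutomaton.language {A : Type} (𝒜 : FinAutomaton A) : Language A :=
  𝒜.toNFA.accepts

/-- Inputs: an automaton for the implementation and one for the specification. Sites, methods and
data values are natural numbers, of which each input uses finitely many. -/
abbrev Input : Type := FinAutomaton (ExecLabel ℕ ℕ ℕ) × FinAutomaton (OpLabel ℕ ℕ)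

/-- All executions of the implementation satisfy the criterion with respect to the
specification. -/
def AllExecutions (c : Criterion) (x : Input) : Prop :=
  ∀ e ∈ x.1.language, c.Holds (execHistory e) x.2.language

/-- The first component of the input is the automaton of an implementation. -/
def ValidInput (x : Input) : Prop :=
  IsImplementation x.1.language

/-- The implementation runs on two sites, numbered `0` and `1`. -/
def TwoSites (x : Input) : Prop :=
  ∀ e ∈ x.1.language, ∀ a ∈ e, a.1 = 0 ∨ a.1 = 1

/-- The problem "does `Q x` hold?", for inputs `x` that satisfy `V`, is decidable: some algorithm
halts with the right answer on every input that satisfies `V`. -/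
def DecidableOn {α : Type} [Primcodable α] (V Q : α → Prop) : Prop :=
  ∃ f : α →. Bool, Partrec f ∧ ∀ x, V x → ∃ b ∈ f x, (b = true ↔ Q x)

/-! ## Counter programs -/

/-- Instructions on integer counters: increment, decrement, test for zero. -/
inductive Instr where
  | inc (r : ℕ)
  | dec (r : ℕ)
  | zero (r : ℕ)

/-- Nondeterministic counter programs: regular expressions over instructions. -/
inductive Prog where
  | skip
  | instr (i : Instr)
  | seq (P Q : Prog)
  | alt (P Q : Prog)
  | star (P : Prog)

/-- The input-output relation of an instruction. -/
def Instr.Rel : Instr → (ℕ → ℤ) → (ℕ → ℤ) → Prop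
  | .inc r, s, t => t = s + Pi.single r 1
  | .dec r, s, t => t = s - Pi.single r 1
  | .zero r, s, t => t = s ∧ s r = 0

namespace Prog

/-- The input-output relation of a program. -/
def Rel : Prog → (ℕ → ℤ) → (ℕ → ℤ) → Prop
  | skip, s, t => t = s
  | instr i, s, t => i.Rel s t
  | seq P Q, s, t => ∃ u, P.Rel s u ∧ Q.Rel u t
  | alt P Q, s, t => P.Rel s t ∨ Q.Rel s t
  | star P, s, t => Relation.ReflTransGen P.Rel s t

theorem rel_star_of_shift {P : Prog} {δ : ℕ → ℤ} (h : ∀ s t, P.Rel s t ↔ t = s + δ)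
    (s t : ℕ → ℤ) : (star P).Rel s t ↔ ∃ n : ℕ, t = s + n • δ := by
  constructor
  · intro hs
    change Relation.ReflTransGen P.Rel s t at hs
    induction hs with
    | refl => exact ⟨0, by simp⟩
    | tail _ h2 ih =>
      obtain ⟨n, rfl⟩ := ih
      exact ⟨n + 1, by rw [(h _ _).1 h2, succ_nsmul, add_assoc]⟩
  · rintro ⟨n, rfl⟩
    induction n with
    | zero => rw [zero_nsmul, add_zero]; exact Relation.ReflTransGen.refl
    | succ n ih => exact ih.tail ((h _ _).2 (by rw [succ_nsmul, add_assoc]))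

/-- A state with natural number values. -/
def st (s : ℕ → ℕ) : ℕ → ℤ := fun i => s i

/-- The results of running `P` from `s` are the states that satisfy `A`. -/
def Does (P : Prog) (s : ℕ → ℕ) (A : (ℕ → ℕ) → Prop) : Prop :=
  ∀ t, P.Rel (st s) t ↔ ∃ u, A u ∧ t = st u

theorem Does.congr {P : Prog} {s : ℕ → ℕ} {A B : (ℕ → ℕ) → Prop} (h : P.Does s A)
    (hAB : ∀ u, A u ↔ B u) : P.Does s B := by
  have : A = B := funext fun u => propext (hAB u)
  exact this ▸ h

theorem Does.bind {P Q : Prog} {s : ℕ → ℕ} {A : (ℕ → ℕ) → Prop} {B : (ℕ → ℕ) → (ℕ → ℕ) → Prop}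
    (hP : P.Does s A) (hQ : ∀ u, A u → Q.Does u (B u)) :
    (seq P Q).Does s (fun v => ∃ u, A u ∧ B u v) := by
  intro t
  constructor
  · rintro ⟨u, h1, h2⟩
    obtain ⟨u, hu, rfl⟩ := (hP _).1 h1
    obtain ⟨v, hv, rfl⟩ := (hQ u hu _).1 h2
    exact ⟨v, ⟨u, hu, hv⟩, rfl⟩
  · rintro ⟨v, ⟨u, hu, hv⟩, rfl⟩
    exact ⟨st u, (hP _).2 ⟨u, hu, rfl⟩, (hQ u hu _).2 ⟨v, hv, rfl⟩⟩

theorem Does.then {P Q : Prog} {s u : ℕ → ℕ} {B : (ℕ → ℕ) → Prop}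
    (hP : P.Does s (fun v => v = u)) (hQ : Q.Does u B) : (seq P Q).Does s B :=
  (hP.bind (B := fun _ => B) (fun _ h => h ▸ hQ)).congr fun v => by simp

theorem Does.test {P Q : Prog} {s : ℕ → ℕ} {p : Prop} {B : (ℕ → ℕ) → Prop}
    (hP : P.Does s (fun v => v = s ∧ p)) (hQ : Q.Does s B) :
    (seq P Q).Does s (fun v => p ∧ B v) :=
  (hP.bind (B := fun _ => B) (fun _ h => h.1 ▸ hQ)).congr fun v => by
    constructor
    · rintro ⟨_, ⟨_, h⟩, h'⟩; exact ⟨h, h'⟩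
    · rintro ⟨h, h'⟩; exact ⟨s, ⟨rfl, h⟩, h'⟩

/-- Add an arbitrary natural number to a counter. -/
def guess (b : ℕ) : Prog := star (instr (.inc b))

/-- Set a counter with a natural number value to zero. -/
def clear (b : ℕ) : Prog := seq (star (instr (.dec b))) (instr (.zero b))

/-- Add a counter with a natural number value to another one, and set it to zero. -/
def move (x y : ℕ) : Prog :=
  seq (star (seq (instr (.dec x)) (instr (.inc y)))) (instr (.zero x))

theorem does_guess {b : ℕ} {s : ℕ → ℕ} (hb : s b = 0) :
    (guess b).Does s (fun v => ∃ y, v = Function.update s b y) := by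
  intro t
  have key : ∀ n : ℕ, st s + n • (Pi.single b 1 : ℕ → ℤ) = st (Function.update s b n) := by
    intro n; funext j
    by_cases hj : j = b
    · subst hj; simp [st, hb]
    · simp [st, hj]
  rw [guess, rel_star_of_shift (δ := Pi.single b 1) fun s t => Iff.rfl]
  simp only [key]
  constructor
  · rintro ⟨n, rfl⟩; exact ⟨_, ⟨n, rfl⟩, rfl⟩
  · rintro ⟨_, ⟨n, rfl⟩, rfl⟩; exact ⟨n, rfl⟩

theorem Does.guess {b : ℕ} {Q : Prog} {s : ℕ → ℕ} {B : ℕ → (ℕ → ℕ) → Prop} (hb : s b = 0)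
    (hQ : ∀ y, Q.Does (Function.update s b y) (B y)) :
    (seq (guess b) Q).Does s (fun v => ∃ y, B y v) :=
  ((does_guess hb).bind (B := fun u => B (u b)) (by rintro _ ⟨y, rfl⟩; simpa using hQ y)).congr
    fun v => by
      constructor
      · rintro ⟨_, ⟨y, rfl⟩, h⟩; exact ⟨_, h⟩
      · rintro ⟨y, h⟩; exact ⟨_, ⟨y, rfl⟩, by simpa using h⟩

theorem does_clear (b : ℕ) (s : ℕ → ℕ) :
    (clear b).Does s (fun v => v = Function.update s b 0) := by
  intro t
  have key : st s + s b • (-Pi.single b 1 : ℕ → ℤ) = st (Function.update s b 0) := by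
    funext j
    by_cases hj : j = b
    · subst hj; simp [st]
    · simp [st, hj]
  change (∃ u, (star (instr (.dec b))).Rel _ u ∧ t = u ∧ u b = 0) ↔ _
  simp only [exists_eq_left]
  constructor
  · rintro ⟨u, h, rfl, h0⟩
    rw [rel_star_of_shift (δ := -Pi.single b 1) fun s t => by
      rw [← sub_eq_add_neg]; exact Iff.rfl] at h
    obtain ⟨n, rfl⟩ := h
    have : n = s b := by simp [st] at h0; omega
    rw [this, key]
  · rintro rfl
    refine ⟨_, ?_, rfl, by simp [st]⟩
    rw [rel_star_of_shift (δ := -Pi.single b 1) fun s t => by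
      rw [← sub_eq_add_neg]; exact Iff.rfl]
    exact ⟨s b, key.symm⟩

theorem does_move {x y : ℕ} (hxy : x ≠ y) {s : ℕ → ℕ} (hy : s y = 0) :
    (move x y).Does s (fun v => v = Function.update (Function.update s y (s x)) x 0) := by
  intro t
  have hl : ∀ s t, (seq (instr (.dec x)) (instr (.inc y))).Rel s t ↔
      t = s + (Pi.single y 1 - Pi.single x 1) := by
    intro s t
    change (∃ u, u = _ ∧ t = _) ↔ _
    rw [exists_eq_left, sub_add_eq_add_sub, add_sub_assoc]
  have key : st s + s x • (Pi.single y 1 - Pi.single x 1 : ℕ → ℤ) =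
      st (Function.update (Function.update s y (s x)) x 0) := by
    funext j
    by_cases hj : j = x
    · subst hj; simp [st, hxy]
    · by_cases hj' : j = y
      · subst hj'; simp [st, hj, hy]
      · simp [st, hj, hj']
  change (∃ u, (star _).Rel _ u ∧ t = u ∧ u x = 0) ↔ _
  simp only [exists_eq_left, rel_star_of_shift hl]
  constructor
  · rintro ⟨u, ⟨n, rfl⟩, rfl, h0⟩
    have : n = s x := by simp [st, hxy] at h0; omega
    rw [this, key]
  · rintro rfl
    exact ⟨_, ⟨s x, key.symm⟩, rfl, by simp [st]⟩

end Prog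

/-! ## Relations tested by programs -/

open Prog

/-- Some program tests whether `ρ` holds of the values of the counters below `b`, using the
counters from `b` on as auxiliary ones, and restores the state. -/
def IsTest (b : ℕ) (ρ : (ℕ → ℕ) → Prop) : Prop :=
  ∃ P : Prog, ∀ s : ℕ → ℕ, (∀ j, b ≤ j → s j = 0) → P.Does s (fun v => v = s ∧ ρ s)

namespace IsTest

variable {b : ℕ} {ρ ρ' : (ℕ → ℕ) → Prop}

theorem congr (h : IsTest b ρ) (hρ : ∀ s, ρ s ↔ ρ' s) : IsTest b ρ' := by
  have : ρ = ρ' := funext fun s => propext (hρ s)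
  exact this ▸ h

theorem true (b : ℕ) : IsTest b (fun _ => True) :=
  ⟨skip, fun s _ t => by
    change t = st s ↔ _
    simp⟩

theorem and (h : IsTest b ρ) (h' : IsTest b ρ') : IsTest b (fun s => ρ s ∧ ρ' s) := by
  obtain ⟨P, hP⟩ := h
  obtain ⟨Q, hQ⟩ := h'
  exact ⟨seq P Q, fun s hs => ((hP s hs).test (hQ s hs)).congr fun v => by tauto⟩

theorem or (h : IsTest b ρ) (h' : IsTest b ρ') : IsTest b (fun s => ρ s ∨ ρ' s) := by
  obtain ⟨P, hP⟩ := h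
  obtain ⟨Q, hQ⟩ := h'
  refine ⟨alt P Q, fun s hs t => ?_⟩
  change P.Rel _ _ ∨ Q.Rel _ _ ↔ _
  rw [hP s hs, hQ s hs, ← exists_or]
  refine exists_congr fun u => ?_
  tauto

theorem update_zero_of {s : ℕ → ℕ} (hb : s b = 0) (y : ℕ) :
    Function.update (Function.update s b y) b 0 = s := by
  rw [Function.update_idem, ← hb, Function.update_eq_self]

theorem ex (h : IsTest (b + 1) ρ) : IsTest b (fun s => ∃ y, ρ (Function.update s b y)) := by
  obtain ⟨P, hP⟩ := h
  refine ⟨seq (guess b) (seq P (clear b)), fun s hs => ?_⟩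
  have hb := hs b le_rfl
  refine (Does.guess hb (B := fun y v => ρ (Function.update s b y) ∧ v = s) fun y => ?_).congr
    fun v => ?_
  · refine (hP _ fun j hj => ?_).test ?_
    · rw [Function.update_of_ne (by omega)]; exact hs j (by omega)
    · simpa [update_zero_of hb] using does_clear b (Function.update s b y)
  · constructor
    · rintro ⟨y, h, h'⟩; exact ⟨h', y, h⟩
    · rintro ⟨h', y, h⟩; exact ⟨y, h, h'⟩

/-- Existential quantification over a fresh counter. -/
theorem exists_fresh {R : (ℕ → ℕ) → ℕ → Prop} (h : IsTest (b + 1) (fun s => R s (s b)))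
    (hR : ∀ s y, R (Function.update s b y) y ↔ R s y) : IsTest b (fun s => ∃ y, R s y) :=
  h.ex.congr fun s => exists_congr fun y => by simpa using hR s y

theorem eq_zero (b i : ℕ) : IsTest b (fun s => s i = 0) :=
  ⟨instr (.zero i), fun s _ t => by
    change t = st s ∧ st s i = 0 ↔ _
    constructor
    · rintro ⟨rfl, h⟩; exact ⟨s, ⟨rfl, by simpa [st] using h⟩, rfl⟩
    · rintro ⟨_, ⟨rfl, h⟩, rfl⟩; exact ⟨rfl, by simpa [st] using h⟩⟩

theorem eq_one (b i : ℕ) : IsTest b (fun s => s i = 1) :=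
  ⟨seq (instr (.dec i)) (seq (instr (.zero i)) (instr (.inc i))), fun s _ t => by
    change (∃ u, u = st s - Pi.single i 1 ∧ ∃ v, (v = u ∧ u i = 0) ∧ t = v + Pi.single i 1) ↔ _
    constructor
    · rintro ⟨_, rfl, _, ⟨rfl, h⟩, rfl⟩
      exact ⟨s, ⟨rfl, by simp [st] at h; omega⟩, by simp⟩
    · rintro ⟨_, ⟨rfl, h⟩, rfl⟩
      exact ⟨_, rfl, _, ⟨rfl, by simp [st, h]⟩, by simp⟩⟩

theorem eq {i j : ℕ} (hi : i < b) (hj : j < b) : IsTest b (fun s => s i = s j) := by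
  by_cases hij : i = j
  · subst hij; simpa using IsTest.true b
  have h1 : ∀ s t, (seq (instr (.dec i)) (seq (instr (.dec j)) (instr (.inc b)))).Rel s t ↔
      t = s + (Pi.single b 1 - Pi.single i 1 - Pi.single j 1) := by
    intro s t
    change (∃ u, u = _ ∧ ∃ v, v = _ ∧ t = _) ↔ _
    simp only [exists_eq_left]
    rw [show s - Pi.single i 1 - Pi.single j 1 + Pi.single b 1 =
      s + (Pi.single b 1 - Pi.single i 1 - Pi.single j 1) by abel]
  have h2 : ∀ s t, (seq (instr (.inc i)) (seq (instr (.inc j)) (instr (.dec b)))).Rel s t ↔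
      t = s + (Pi.single i 1 + Pi.single j 1 - Pi.single b 1) := by
    intro s t
    change (∃ u, u = _ ∧ ∃ v, v = _ ∧ t = _) ↔ _
    simp only [exists_eq_left]
    rw [show s + Pi.single i 1 + Pi.single j 1 - Pi.single b 1 =
      s + (Pi.single i 1 + Pi.single j 1 - Pi.single b 1) by abel]
  refine ⟨seq (star (seq (instr (.dec i)) (seq (instr (.dec j)) (instr (.inc b)))))
    (seq (instr (.zero i)) (seq (instr (.zero j))
      (seq (star (seq (instr (.inc i)) (seq (instr (.inc j)) (instr (.dec b)))))
        (instr (.zero b))))), fun s hs t => ?_⟩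
  have hb := hs b le_rfl
  have e1 : ¬ b = i := by omega
  have e2 : ¬ b = j := by omega
  have e3 : ¬ i = b := by omega
  have e4 : ¬ j = b := by omega
  have e5 : ¬ j = i := by omega
  change (∃ u, (star _).Rel _ u ∧ ∃ v, (v = u ∧ u i = 0) ∧ ∃ w, (w = v ∧ v j = 0) ∧
    ∃ x, (star _).Rel w x ∧ t = x ∧ x b = 0) ↔ _
  simp only [rel_star_of_shift h1, rel_star_of_shift h2]
  constructor
  · rintro ⟨_, ⟨n, rfl⟩, _, ⟨rfl, hi0⟩, _, ⟨rfl, hj0⟩, _, ⟨m, rfl⟩, rfl, hb0⟩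
    simp [st, hb, hij, e1, e2, e3, e4, e5] at hi0 hj0 hb0
    obtain rfl : m = n := by omega
    refine ⟨s, ⟨rfl, by omega⟩, ?_⟩
    module
  · rintro ⟨u, ⟨hu, h⟩, rfl⟩
    subst u
    refine ⟨_, ⟨s i, rfl⟩, _, ⟨rfl, ?_⟩, _, ⟨rfl, ?_⟩, _, ⟨s i, rfl⟩, ?_, ?_⟩
    · simp [st, hij, e3]
    · simp [st, h, e4, e5]
    · module
    · simp [st, hb, e1, e2]

theorem add_of_ne {x y z : ℕ} (hx : x < b) (hy : y < b) (hz : z < b) (hxy : x ≠ y) (hxz : x ≠ z)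
    (hyz : y ≠ z) : IsTest b (fun s => s x = s y + s z) := by
  have h1 : ∀ i j k s t,
      (seq (instr (.dec i)) (seq (instr (.dec j)) (instr (.inc k)))).Rel s t ↔
      t = s + (Pi.single k 1 - Pi.single i 1 - Pi.single j 1) := by
    intro i j k s t
    change (∃ u, u = _ ∧ ∃ v, v = _ ∧ t = _) ↔ _
    simp only [exists_eq_left]
    rw [show s - Pi.single i 1 - Pi.single j 1 + Pi.single k 1 =
      s + (Pi.single k 1 - Pi.single i 1 - Pi.single j 1) by abel]
  have h2 : ∀ i j k s t,
      (seq (instr (.inc i)) (seq (instr (.inc j)) (instr (.dec k)))).Rel s t ↔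
      t = s + (Pi.single i 1 + Pi.single j 1 - Pi.single k 1) := by
    intro i j k s t
    change (∃ u, u = _ ∧ ∃ v, v = _ ∧ t = _) ↔ _
    simp only [exists_eq_left]
    rw [show s + Pi.single i 1 + Pi.single j 1 - Pi.single k 1 =
      s + (Pi.single i 1 + Pi.single j 1 - Pi.single k 1) by abel]
  refine ⟨seq (star (seq (instr (.dec x)) (seq (instr (.dec y)) (instr (.inc b)))))
    (seq (star (seq (instr (.dec x)) (seq (instr (.dec z)) (instr (.inc (b + 1))))))
    (seq (instr (.zero x)) (seq (instr (.zero y)) (seq (instr (.zero z))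
    (seq (star (seq (instr (.inc x)) (seq (instr (.inc y)) (instr (.dec b)))))
    (seq (star (seq (instr (.inc x)) (seq (instr (.inc z)) (instr (.dec (b + 1))))))
    (seq (instr (.zero b)) (instr (.zero (b + 1)))))))))), fun s hs t => ?_⟩
  have hb := hs b le_rfl
  have hb' := hs (b + 1) (by omega)
  have e1 : ¬ b = x := by omega
  have e2 : ¬ b = y := by omega
  have e3 : ¬ b = z := by omega
  have e4 : ¬ x = b := by omega
  have e5 : ¬ y = b := by omega
  have e6 : ¬ z = b := by omega
  have f1 : ¬ b + 1 = x := by omega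
  have f2 : ¬ b + 1 = y := by omega
  have f3 : ¬ b + 1 = z := by omega
  have f4 : ¬ x = b + 1 := by omega
  have f5 : ¬ y = b + 1 := by omega
  have f6 : ¬ z = b + 1 := by omega
  change (∃ a1, (star _).Rel _ a1 ∧ ∃ a2, (star _).Rel a1 a2 ∧ ∃ a3, (a3 = a2 ∧ a2 x = 0) ∧
    ∃ a4, (a4 = a3 ∧ a3 y = 0) ∧ ∃ a5, (a5 = a4 ∧ a4 z = 0) ∧
    ∃ a6, (star _).Rel a5 a6 ∧ ∃ a7, (star _).Rel a6 a7 ∧ ∃ a8, (a8 = a7 ∧ a7 b = 0) ∧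
    t = a8 ∧ a8 (b + 1) = 0) ↔ _
  simp only [rel_star_of_shift (h1 _ _ _), rel_star_of_shift (h2 _ _ _)]
  constructor
  · rintro ⟨_, ⟨n, rfl⟩, _, ⟨m, rfl⟩, _, ⟨rfl, hx0⟩, _, ⟨rfl, hy0⟩, _, ⟨rfl, hz0⟩,
      _, ⟨n', rfl⟩, _, ⟨m', rfl⟩, _, ⟨rfl, hb0⟩, rfl, hb0'⟩
    simp [st, hb, hb', e1, e2, e3, e4, e5, e6, f1, f2, f3, f4, f5, f6, hxy, hxz, hyz,
      hxy.symm, hxz.symm, hyz.symm] at hx0 hy0 hz0 hb0 hb0'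
    obtain rfl : n' = n := by omega
    obtain rfl : m' = m := by omega
    refine ⟨s, ⟨rfl, by omega⟩, ?_⟩
    module
  · rintro ⟨u, ⟨hu, h⟩, rfl⟩
    subst u
    refine ⟨_, ⟨s y, rfl⟩, _, ⟨s z, rfl⟩, _, ⟨rfl, ?_⟩, _, ⟨rfl, ?_⟩, _, ⟨rfl, ?_⟩,
      _, ⟨s y, rfl⟩, _, ⟨s z, rfl⟩, _, ⟨rfl, ?_⟩, ?_, ?_⟩
    · simp [st, h, hxy, hxz, e4, f4]
    · simp [st, hxy.symm, hyz, e5, f5]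
    · simp [st, hxz.symm, hyz.symm, e6, f6]
    · simp [st, hb, e1, e2, e3]
    · module
    · simp [st, hb', f1, f2, f3]

end IsTest

namespace IsTest

variable {b : ℕ} {ρ ρ' : (ℕ → ℕ) → Prop}

theorem add {i j k : ℕ} (hi : i < b) (hj : j < b) (hk : k < b) :
    IsTest b (fun s => s i = s j + s k) := by
  have h : IsTest (b + 1 + 1 + 1) (fun s => (s b = s i ∧ s (b + 1) = s j ∧ s (b + 2) = s k) ∧
      s b = s (b + 1) + s (b + 2)) :=
    ((eq (by omega) (by omega)).and ((eq (by omega) (by omega)).and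
      (eq (by omega) (by omega)))).and
      (add_of_ne (by omega) (by omega) (by omega) (by omega) (by omega) (by omega))
  refine h.ex.ex.ex.congr fun s => ?_
  have e1 : i ≠ b := by omega
  have e2 : j ≠ b := by omega
  have e3 : k ≠ b := by omega
  have f1 : i ≠ b + 1 := by omega
  have f2 : j ≠ b + 1 := by omega
  have f3 : k ≠ b + 1 := by omega
  have g1 : i ≠ b + 1 + 1 := by omega
  have g2 : j ≠ b + 1 + 1 := by omega
  have g3 : k ≠ b + 1 + 1 := by omega
  simp only [Function.update_apply]
  simp [e1, e2, e3, f1, f2, f3, g1, g2, g3]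

theorem succ {i j : ℕ} (hi : i < b) (hj : j < b) : IsTest b (fun s => s i = s j + 1) := by
  refine (exists_fresh (R := fun s y => y = 1 ∧ s i = s j + y)
    ((eq_one _ _).and (add (by omega) (by omega) (by omega))) fun s y => ?_).congr fun s => ?_
  · simp [hi.ne, hj.ne]
  · simp

theorem le {i j : ℕ} (hi : i < b) (hj : j < b) : IsTest b (fun s => s i ≤ s j) := by
  refine (exists_fresh (R := fun s y => s j = s i + y)
    (add (by omega) (by omega) (by omega)) fun s y => ?_).congr fun s => ?_
  · simp [hi.ne, hj.ne]
  · exact le_iff_exists_add.symm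

theorem lt {i j : ℕ} (hi : i < b) (hj : j < b) : IsTest b (fun s => s i < s j) := by
  refine (exists_fresh (R := fun s y => y = s i + 1 ∧ y ≤ s j)
    ((succ (by omega) (by omega)).and (le (by omega) (by omega))) fun s y => ?_).congr fun s => ?_
  · simp [hi.ne, hj.ne]
  · simp

/-- The state in which the counters `b` and `b + 1` hold the components of `c`. -/
def update₂ (s : ℕ → ℕ) (b : ℕ) (c : ℕ × ℕ) : ℕ → ℕ :=
  Function.update (Function.update s b c.1) (b + 1) c.2

theorem reflTransGen (h : IsTest (b + 4) ρ) {i j i' j' : ℕ} (hi : i < b) (hj : j < b)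
    (hi' : i' < b) (hj' : j' < b) :
    IsTest b (fun s => Relation.ReflTransGen
      (fun c d : ℕ × ℕ => ρ (update₂ (update₂ s b c) (b + 2) d)) (s i, s j) (s i', s j')) := by
  obtain ⟨P, hP⟩ := h
  obtain ⟨Q₁, hQ₁⟩ : IsTest (b + 2) (fun s => s b = s i ∧ s (b + 1) = s j) :=
    (eq (by omega) (by omega)).and (eq (by omega) (by omega))
  obtain ⟨Q₂, hQ₂⟩ : IsTest (b + 2) (fun s => s b = s i' ∧ s (b + 1) = s j') :=
    (eq (by omega) (by omega)).and (eq (by omega) (by omega))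
  let body : Prog := seq (guess (b + 2)) (seq (guess (b + 3)) (seq P (seq (clear b)
    (seq (clear (b + 1)) (seq (move (b + 2) b) (move (b + 3) (b + 1)))))))
  refine ⟨seq (guess b) (seq (guess (b + 1)) (seq Q₁ (seq (star body) (seq Q₂
    (seq (clear b) (clear (b + 1))))))), fun s hs => ?_⟩
  have hbody : ∀ c, body.Does (update₂ s b c) (fun v => ∃ x y,
      ρ (update₂ (update₂ s b c) (b + 2) (x, y)) ∧ v = update₂ s b (x, y)) := by
    intro c
    refine Does.guess (by simp [update₂, hs]) fun x =>
      Does.guess (by simp [update₂, hs]) fun y =>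
      Does.test (hP _ ?_) ((does_clear _ _).then ((does_clear _ _).then
        (((does_move (by omega) ?_).then ((does_move (by omega) ?_).congr ?_)))))
    · intro j hj
      simp only [update₂, Function.update_apply]
      rw [if_neg (by omega), if_neg (by omega), if_neg (by omega), if_neg (by omega)]
      exact hs _ (by omega)
    · simp
    · simp
    · intro u
      have : ∀ u w : ℕ → ℕ, u = w → ∀ v : ℕ → ℕ, (v = u ↔ v = w) := by rintro u _ rfl v; rfl
      refine this _ _ ?_ u
      funext k
      simp only [update₂, Function.update_apply]
      have h2 := hs (b + 2) (by omega)
      have h3 := hs (b + 3) (by omega)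
      split_ifs <;> first | omega | (subst_vars; omega)
  have hstar : ∀ c, (star body).Does (update₂ s b c) (fun v => ∃ d, Relation.ReflTransGen
      (fun c d : ℕ × ℕ => ρ (update₂ (update₂ s b c) (b + 2) d)) c d ∧ v = update₂ s b d) := by
    intro c t
    constructor
    · intro h
      change Relation.ReflTransGen _ _ _ at h
      induction h with
      | refl => exact ⟨_, ⟨c, .refl, rfl⟩, rfl⟩
      | tail _ h ih =>
        obtain ⟨_, ⟨d, hd, rfl⟩, rfl⟩ := ih
        obtain ⟨_, ⟨x, y, hxy, rfl⟩, rfl⟩ := (hbody d _).1 h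
        exact ⟨_, ⟨(x, y), hd.tail hxy, rfl⟩, rfl⟩
    · rintro ⟨_, ⟨d, hd, rfl⟩, rfl⟩
      change Relation.ReflTransGen _ _ _
      induction hd with
      | refl => exact .refl
      | @tail d e _ h ih =>
        exact ih.tail ((hbody d _).2 ⟨_, ⟨e.1, e.2, h, rfl⟩, rfl⟩)
  have h0 : ∀ c j, b + 2 ≤ j → update₂ s b c j = 0 := by
    intro c j hj
    simp only [update₂, Function.update_apply]
    rw [if_neg (by omega), if_neg (by omega)]
    exact hs _ (by omega)
  have hrest : ∀ c, (seq Q₂ (seq (clear b) (clear (b + 1)))).Does (update₂ s b c)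
      (fun v => c = (s i', s j') ∧ v = s) := by
    intro c
    refine (Does.test (hQ₂ _ (h0 c)) ((does_clear _ _).then (does_clear _ _))).congr fun v => ?_
    refine and_congr ?_ (iff_of_eq (congrArg _ ?_))
    · simp [update₂, hi'.ne, hj'.ne, Prod.ext_iff,
        (show i' ≠ b + 1 by omega), (show j' ≠ b + 1 by omega)]
    · funext k
      simp only [update₂, Function.update_apply]
      split_ifs with h1 h2
      · rw [hs k (by omega)]
      · rw [hs k (by omega)]
      · rfl
  refine (Does.guess (hs _ le_rfl) fun x => Does.guess
    (by simp [hs]) fun y => Does.test (hQ₁ _ (h0 (x, y)))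
    ((hstar (x, y)).bind (B := fun u v => (u b, u (b + 1)) = (s i', s j') ∧ v = s) ?_)).congr
      fun v => ?_
  · rintro _ ⟨d, _, rfl⟩
    exact (hrest d).congr fun v => by simp [update₂, Prod.ext_iff]
  · have hx : ∀ x y, (update₂ s b (x, y) b = update₂ s b (x, y) i ∧
        update₂ s b (x, y) (b + 1) = update₂ s b (x, y) j) ↔ (x = s i ∧ y = s j) := by
      intro x y
      simp [update₂, hi.ne, hj.ne,
        (show i ≠ b + 1 by omega), (show j ≠ b + 1 by omega)]
    have hd : ∀ d, (update₂ s b d b, update₂ s b d (b + 1)) = d := by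
      intro d; simp [update₂]
    constructor
    · rintro ⟨x, y, hxy, _, ⟨d, hd', rfl⟩, h, rfl⟩
      rw [hd] at h
      obtain ⟨rfl, rfl⟩ := (hx x y).1 hxy
      subst h
      exact ⟨rfl, hd'⟩
    · rintro ⟨rfl, h⟩
      exact ⟨v i, v j, (hx _ _).2 ⟨rfl, rfl⟩, _, ⟨_, h, rfl⟩, hd _, rfl⟩

end IsTest

theorem reflTransGen_counting {G : ℕ → ℕ → ℕ → Prop} {F : ℕ → ℕ → Prop} {y : ℕ}
    (h0 : ∀ x, F 0 x ↔ x = y) (hs : ∀ n x, F (n + 1) x ↔ ∃ z, F n z ∧ G n z x) (n x : ℕ) :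
    Relation.ReflTransGen (fun c d : ℕ × ℕ => d.1 = c.1 + 1 ∧ G c.1 c.2 d.2) (0, y) (n, x) ↔
      F n x := by
  constructor
  · intro h
    have : ∀ d, Relation.ReflTransGen
        (fun c d : ℕ × ℕ => d.1 = c.1 + 1 ∧ G c.1 c.2 d.2) (0, y) d → F d.1 d.2 := by
      intro d hd
      induction hd with
      | refl => exact (h0 _).2 rfl
      | tail _ h ih => rw [h.1]; exact (hs _ _).2 ⟨_, ih, h.2⟩
    exact this _ h
  · intro h
    induction n generalizing x with
    | zero => rw [(h0 _).1 h]
    | succ n ih =>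
      obtain ⟨z, hz, hG⟩ := (hs _ _).1 h
      exact (ih _ hz).tail ⟨rfl, hG⟩

namespace IsTest

variable {b : ℕ}

theorem counting {G : (ℕ → ℕ) → ℕ → ℕ → ℕ → Prop} {j i' j' : ℕ} (hj : j < b) (hi' : i' < b)
    (hj' : j' < b)
    (hG : ∀ i x y, b ≤ i → b ≤ x → b ≤ y →
      ∀ b', i < b' → x < b' → y < b' → IsTest b' (fun s => G s (s i) (s x) (s y)))
    (hb : ∀ s s' : ℕ → ℕ, (∀ k < b, s k = s' k) → G s = G s') :
    IsTest b (fun s => Relation.ReflTransGen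
      (fun c d : ℕ × ℕ => d.1 = c.1 + 1 ∧ G s c.1 c.2 d.2) (0, s j) (s i', s j')) := by
  refine (exists_fresh (R := fun s z => z = 0 ∧ Relation.ReflTransGen
      (fun c d : ℕ × ℕ => d.1 = c.1 + 1 ∧ G s c.1 c.2 d.2) (z, s j) (s i', s j'))
    ((eq_zero _ _).and ((reflTransGen (i := b) (j := j) (i' := i') (j' := j') (ρ := fun s =>
      s (b + 3) = s (b + 1) + 1 ∧ G s (s (b + 1)) (s (b + 2)) (s (b + 4)))
      ((succ (by omega) (by omega)).and
        (hG _ _ _ (by omega) (by omega) (by omega) _ (by omega) (by omega) (by omega)))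
      (by omega) (by omega) (by omega) (by omega)).congr ?_)) ?_).congr ?_
  · intro s
    have : ∀ c d, G (update₂ (update₂ s (b + 1) c) (b + 1 + 2) d) = G s := fun c d =>
      hb _ _ fun k hk => by
        simp only [update₂, Function.update_apply]
        rw [if_neg (by omega), if_neg (by omega), if_neg (by omega), if_neg (by omega)]
    simp only [this]
    simp [update₂]
  · intro s y
    rw [hb (Function.update s b y) s fun k hk => by simp [hk.ne]]
    simp [hj.ne, hi'.ne, hj'.ne]
  · intro s
    simp

theorem mul {i j k : ℕ} (hi : i < b) (hj : j < b) (hk : k < b) :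
    IsTest b (fun s => s k = s i * s j) := by
  refine (exists_fresh (R := fun s z => z = 0 ∧ Relation.ReflTransGen
      (fun c d : ℕ × ℕ => d.1 = c.1 + 1 ∧ d.2 = c.2 + s i) (0, z) (s j, s k))
    ((eq_zero _ _).and (counting (j := b) (i' := j) (j' := k) (G := fun s _ z x => x = z + s i)
      (by omega) (by omega) (by omega) ?_ ?_)) ?_).congr ?_
  · intro _ x y _ _ _ b' _ hx hy
    exact add (by omega) (by omega) (by omega)
  · intro s s' h
    rw [h i (by omega)]
  · intro s y
    simp [hi.ne, hj.ne, hk.ne]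
  · intro s
    simp only [exists_eq_left]
    exact reflTransGen_counting (F := fun n x => x = s i * n) (G := fun _ z x => x = z + s i)
      (by simp) (by simp [Nat.mul_succ]) _ _

theorem natPair {i j k : ℕ} (hi : i < b) (hj : j < b) (hk : k < b) :
    IsTest b (fun s => s k = Nat.pair (s i) (s j)) := by
  have h1 : IsTest b (fun s => ∃ q, q = s j * s j ∧ s k = q + s i) :=
    exists_fresh (R := fun s q => q = s j * s j ∧ s k = q + s i)
      ((mul (by omega) (by omega) (by omega)).and (add (by omega) (by omega) (by omega)))
      fun s y => by simp [hi.ne, hj.ne, hk.ne]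
  have h2 : IsTest (b + 1) (fun s => ∃ r, r = s b + s i ∧ s k = r + s j) :=
    exists_fresh (R := fun s r => r = s b + s i ∧ s k = r + s j)
      ((add (by omega) (by omega) (by omega)).and (add (by omega) (by omega) (by omega)))
      fun s y => by
        simp [show i ≠ b + 1 by omega, show j ≠ b + 1 by omega, show k ≠ b + 1 by omega]
  have h3 : IsTest b (fun s => ∃ q, q = s i * s i ∧ ∃ r, r = q + s i ∧ s k = r + s j) :=
    exists_fresh (R := fun s q => q = s i * s i ∧ ∃ r, r = q + s i ∧ s k = r + s j)
      ((mul (by omega) (by omega) (by omega)).and h2)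
      fun s y => by simp [hi.ne, hj.ne, hk.ne]
  refine (((lt hi hj).and h1).or ((le hj hi).and h3)).congr fun s => ?_
  simp only [exists_eq_left, Nat.pair]
  split_ifs with h
  · simp [h]
  · simp [h, not_lt.1 h]

end IsTest

/-- Programs can test the graph of the partial function `f`. -/
def IsGraph (f : ℕ →. ℕ) : Prop :=
  ∀ b i j, i < b → j < b → IsTest b (fun s => s j ∈ f (s i))

namespace IsGraph

open IsTest

variable {f g : ℕ →. ℕ}

theorem comp (hf : IsGraph f) (hg : IsGraph g) : IsGraph (fun n => g n >>= f) := by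
  intro b i j hi hj
  refine (exists_fresh (R := fun s y => y ∈ g (s i) ∧ s j ∈ f y)
    ((hg _ _ _ (by omega) (by omega)).and (hf _ _ _ (by omega) (by omega))) ?_).congr ?_
  · intro s y; simp [hi.ne, hj.ne]
  · intro s; exact Part.mem_bind_iff.symm

theorem pair (hf : IsGraph f) (hg : IsGraph g) :
    IsGraph (fun n => Nat.pair <$> f n <*> g n) := by
  intro b i j hi hj
  refine (exists_fresh (R := fun s x => x ∈ f (s i) ∧ ∃ y, y ∈ g (s i) ∧ s j = Nat.pair x y)
    ((hf _ _ _ (by omega) (by omega)).and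
      (exists_fresh (R := fun s y => y ∈ g (s i) ∧ s j = Nat.pair (s b) y)
        ((hg _ _ _ (by omega) (by omega)).and (natPair (by omega) (by omega) (by omega)))
        ?_)) ?_).congr ?_
  · intro s y; simp [show i ≠ b + 1 by omega, show j ≠ b + 1 by omega]
  · intro s y; simp [hi.ne, hj.ne]
  · intro s; simp [Seq.seq, eq_comm]

theorem left : IsGraph (fun n => Part.some n.unpair.1) := by
  intro b i j hi hj
  refine (exists_fresh (R := fun s y => s i = Nat.pair (s j) y)
    (natPair (by omega) (by omega) (by omega)) ?_).congr ?_
  · intro s y; simp [hi.ne, hj.ne]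
  · intro s
    rw [Part.mem_some_iff]
    constructor
    · rintro ⟨y, h⟩; simp [h]
    · intro h; exact ⟨(s i).unpair.2, by simp [h]⟩

theorem right : IsGraph (fun n => Part.some n.unpair.2) := by
  intro b i j hi hj
  refine (exists_fresh (R := fun s y => s i = Nat.pair y (s j))
    (natPair (by omega) (by omega) (by omega)) ?_).congr ?_
  · intro s y; simp [hi.ne, hj.ne]
  · intro s
    rw [Part.mem_some_iff]
    constructor
    · rintro ⟨y, h⟩; simp [h]
    · intro h; exact ⟨(s i).unpair.1, by simp [h]⟩

theorem prec (hf : IsGraph f) (hg : IsGraph g) :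
    IsGraph (Nat.unpaired fun a n => n.rec (f a) fun y IH => do
      let i ← IH; g (Nat.pair a (Nat.pair y i))) := by
  intro b i j hi hj
  let T : ℕ → ℕ → ℕ → ℕ → Prop := fun a m z x => x ∈ g (Nat.pair a (Nat.pair m z))
  have hT : ∀ b a m z x, a < b → m < b → z < b → x < b →
      IsTest b (fun s => T (s a) (s m) (s z) (s x)) := by
    intro b a m z x ha hm hz hx
    refine (exists_fresh (R := fun s p => p = Nat.pair (s m) (s z) ∧
      ∃ q, q = Nat.pair (s a) p ∧ s x ∈ g q)
      ((natPair (by omega) (by omega) (by omega)).and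
        (exists_fresh (R := fun s q => q = Nat.pair (s a) (s b) ∧ s x ∈ g q)
          ((natPair (by omega) (by omega) (by omega)).and (hg _ _ _ (by omega) (by omega)))
          ?_)) ?_).congr ?_
    · intro s y; simp [show a ≠ b + 1 by omega, show x ≠ b + 1 by omega]
    · intro s y; simp [ha.ne, hm.ne, hz.ne, hx.ne]
    · intro s; simp [T]
  have h3 : IsTest (b + 2) (fun s => ∃ y, y ∈ f (s b) ∧ Relation.ReflTransGen
      (fun c d : ℕ × ℕ => d.1 = c.1 + 1 ∧ T (s b) c.1 c.2 d.2) (0, y) (s (b + 1), s j)) := by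
    refine exists_fresh (R := fun s y => y ∈ f (s b) ∧ Relation.ReflTransGen
      (fun c d : ℕ × ℕ => d.1 = c.1 + 1 ∧ T (s b) c.1 c.2 d.2) (0, y) (s (b + 1), s j))
      ((hf _ _ _ (by omega) (by omega)).and (counting (j := b + 2) (i' := b + 1) (j' := j)
        (G := fun s => T (s b)) (by omega) (by omega) (by omega) ?_ ?_)) ?_
    · intro m z x _ _ _ b' hm hz hx
      exact hT _ _ _ _ _ (by omega) hm hz hx
    · intro s s' h
      rw [h b (by omega)]
    · intro s y
      simp [show j ≠ b + 2 by omega]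
  refine (exists_fresh (R := fun s a => ∃ n, s i = Nat.pair a n ∧ ∃ y, y ∈ f a ∧
      Relation.ReflTransGen (fun c d : ℕ × ℕ => d.1 = c.1 + 1 ∧ T a c.1 c.2 d.2) (0, y) (n, s j))
    (exists_fresh (R := fun s n => s i = Nat.pair (s b) n ∧ ∃ y, y ∈ f (s b) ∧
      Relation.ReflTransGen (fun c d : ℕ × ℕ => d.1 = c.1 + 1 ∧ T (s b) c.1 c.2 d.2)
        (0, y) (n, s j))
      ((natPair (by omega) (by omega) (by omega)).and h3) ?_) ?_).congr ?_
  · intro s y; simp [show i ≠ b + 1 by omega, show j ≠ b + 1 by omega]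
  · intro s y; simp [hi.ne, hj.ne]
  · intro s
    have key : ∀ a n x : ℕ, (∃ y, y ∈ f a ∧ Relation.ReflTransGen
        (fun c d : ℕ × ℕ => d.1 = c.1 + 1 ∧ T a c.1 c.2 d.2) (0, y) (n, x)) ↔
        x ∈ (n.rec (f a) fun y IH => do
          let i ← IH; g (Nat.pair a (Nat.pair y i)) : Part ℕ) := by
      intro a n x
      by_cases hfa : ∃ y, y ∈ f a
      · obtain ⟨y, hy⟩ := hfa
        rw [← reflTransGen_counting (G := T a) (y := y) (F := fun (n x : ℕ) =>
          x ∈ (n.rec (f a) fun y IH => do let i ← IH; g (Nat.pair a (Nat.pair y i)) : Part ℕ))]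
        · constructor
          · rintro ⟨y', hy', h⟩
            rwa [Part.mem_unique hy hy']
          · intro h; exact ⟨y, hy, h⟩
        · intro x
          exact ⟨fun h => Part.mem_unique h hy, fun h => h ▸ hy⟩
        · intro n x
          simp [T]
      · push Not at hfa
        have : f a = Part.none := Part.eq_none_iff.2 hfa
        constructor
        · rintro ⟨y, hy, _⟩; exact absurd hy (hfa y)
        · have : ∀ n : ℕ, (n.rec (f a) fun y IH => do
              let i ← IH; g (Nat.pair a (Nat.pair y i)) : Part ℕ) = Part.none := by
            intro n
            induction n with
            | zero => exact this
            | succ n ih => exact (congrArg (Part.bind · _) ih).trans (Part.bind_none _)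
          rw [this]
          exact fun h => absurd h (Part.notMem_none x)
    simp only [key, Nat.unpaired]
    constructor
    · rintro ⟨a, n, h, h'⟩; simpa [h] using h'
    · intro h; exact ⟨_, _, (Nat.pair_unpair _).symm, h⟩

theorem rfind (hf : IsGraph f) :
    IsGraph (fun a => Nat.rfind fun n => (fun m => m = 0) <$> f (Nat.pair a n)) := by
  intro b i j hi hj
  let T : ℕ → ℕ → ℕ → ℕ → Prop := fun a m z x => x = z ∧ ∃ w, w + 1 ∈ f (Nat.pair a m)
  have hT : ∀ b a m z x, a < b → m < b → z < b → x < b →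
      IsTest b (fun s => T (s a) (s m) (s z) (s x)) := by
    intro b a m z x ha hm hz hx
    refine (eq hx hz).and ((exists_fresh (R := fun s p => p = Nat.pair (s a) (s m) ∧
      ∃ w v, v = w + 1 ∧ v ∈ f p)
      ((natPair (by omega) (by omega) (by omega)).and
        (exists_fresh (R := fun s w => ∃ v, v = w + 1 ∧ v ∈ f (s b))
          (exists_fresh (R := fun s v => v = s (b + 1) + 1 ∧ v ∈ f (s b))
            ((succ (by omega) (by omega)).and (hf _ _ _ (by omega) (by omega)))
          ?_) ?_)) ?_).congr ?_)
    · intro s y; simp [show b ≠ b + 1 + 1 by omega]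
    · intro s y; simp
    · intro s y; simp [ha.ne, hm.ne]
    · intro s; simp
  refine (exists_fresh (R := fun s z => z = 0 ∧ (∃ q, q = Nat.pair (s i) (s j) ∧ z ∈ f q) ∧
      Relation.ReflTransGen (fun c d : ℕ × ℕ => d.1 = c.1 + 1 ∧ T (s i) c.1 c.2 d.2)
        (0, z) (s j, z))
    ((eq_zero _ _).and ((exists_fresh (R := fun s q => q = Nat.pair (s i) (s j) ∧ s b ∈ f q)
      ((natPair (by omega) (by omega) (by omega)).and (hf _ _ _ (by omega) (by omega))) ?_).and
      (counting (j := b) (i' := j) (j' := b) (G := fun s => T (s i))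
        (by omega) (by omega) (by omega) ?_ ?_))) ?_).congr ?_
  · intro s y; simp [show i ≠ b + 1 by omega, show j ≠ b + 1 by omega]
  · intro m z x _ _ _ b' hm hz hx
    exact hT _ _ _ _ _ (by omega) hm hz hx
  · intro s s' h
    rw [h i (by omega)]
  · intro s y; simp [hi.ne, hj.ne]
  · intro s
    simp only [exists_eq_left]
    rw [reflTransGen_counting (G := T (s i)) (y := 0) (F := fun n x => x = 0 ∧
      ∀ m < n, ∃ w, w + 1 ∈ f (Nat.pair (s i) m))]
    · refine Iff.trans (and_congr ?_ ?_) Nat.mem_rfind.symm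
      · simp
      · simp only [true_and]
        refine forall_congr' fun m => ?_
        refine ⟨fun h hm => ?_, fun h hm => ?_⟩
        · obtain ⟨w, hw⟩ := h hm
          exact (Part.mem_map_iff _).2 ⟨_, hw, by simp⟩
        · obtain ⟨w, hw, h0⟩ := (Part.mem_map_iff _).1 (h hm)
          obtain ⟨v, rfl⟩ := Nat.exists_eq_succ_of_ne_zero (of_decide_eq_false h0)
          exact ⟨v, hw⟩
    · simp
    · intro n x
      simp only [T, Nat.lt_succ_iff_lt_or_eq, or_imp, forall_and, forall_eq]
      constructor
      · rintro ⟨rfl, h, h'⟩; exact ⟨0, ⟨rfl, h⟩, rfl, h'⟩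
      · rintro ⟨_, ⟨rfl, h⟩, rfl, h'⟩; exact ⟨rfl, h, h'⟩

theorem of_partrec (h : Nat.Partrec f) : IsGraph f := by
  induction h with
  | zero => exact fun b i j _ _ => (eq_zero b j).congr fun s => Part.mem_some_iff.symm
  | succ => exact fun b i j hi hj => (succ hj hi).congr fun s => Part.mem_some_iff.symm
  | left => exact left
  | right => exact right
  | pair _ _ hf hg => exact hf.pair hg
  | comp _ _ hf hg => exact hf.comp hg
  | prec _ _ hf hg => exact hf.prec hg
  | rfind _ hf => exact hf.rfind

end IsGraph

/-- Some program that starts with `n` in counter `0` can reach the zero state if and only if the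
given partial recursive function is defined at `n`. -/
theorem exists_prog_rel_zero_iff_dom {f : ℕ →. ℕ} (h : Nat.Partrec f) :
    ∃ P : Prog, ∀ n : ℕ, P.Rel (Pi.single 0 (n : ℤ)) 0 ↔ (f n).Dom := by
  obtain ⟨P, hP⟩ : IsTest 1 (fun s => ∃ y, y ∈ f (s 0)) :=
    IsTest.exists_fresh (R := fun s y => y ∈ f (s 0))
      (IsGraph.of_partrec h _ _ _ (by omega) (by omega)) fun s y => by simp
  refine ⟨seq P (clear 0), fun n => ?_⟩
  have e : (Pi.single 0 (n : ℤ) : ℕ → ℤ) = st (Pi.single 0 n) := by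
    funext j
    by_cases hj : j = 0
    · subst hj; simp [st]
    · simp [st, hj]
  rw [e, Does.test (hP (Pi.single 0 n) fun j hj => Pi.single_eq_of_ne (by omega) _)
    (does_clear _ _), Part.dom_iff_mem]
  constructor
  · rintro ⟨_, ⟨h, _⟩, _⟩; simpa using h
  · intro h
    refine ⟨_, ⟨by simpa using h, rfl⟩, ?_⟩
    funext j
    by_cases hj : j = 0
    · subst hj; simp [st]
    · simp [st, hj]

open scoped Computability

/-! ## Words of instructions -/

/-- Running a word of instructions. -/
def Instr.Run (s : ℕ → ℤ) : List Instr → (ℕ → ℤ) → Prop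
  | [], t => t = s
  | i :: w, t => ∃ u, i.Rel s u ∧ Instr.Run u w t

/-- The counter that an instruction uses. -/
def Instr.reg : Instr → ℕ
  | .inc r => r
  | .dec r => r
  | .zero r => r

theorem Instr.run_append {s t : ℕ → ℤ} {v w : List Instr} :
    Instr.Run s (v ++ w) t ↔ ∃ u, Instr.Run s v u ∧ Instr.Run u w t := by
  induction v generalizing s with
  | nil => simp [Instr.Run]
  | cons i v ih =>
    simp only [List.cons_append, Instr.Run, ih]
    constructor
    · rintro ⟨a, ha, b, hb, h⟩; exact ⟨b, ⟨a, ha, hb⟩, h⟩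
    · rintro ⟨b, ⟨a, ha, hb⟩, h⟩; exact ⟨a, ha, b, hb, h⟩

namespace Prog

/-- The words of instructions that a program can execute. -/
def words : Prog → Language Instr
  | skip => 1
  | instr i => {[i]}
  | seq P Q => P.words * Q.words
  | alt P Q => P.words + Q.words
  | star P => P.words∗

theorem rel_iff_exists_run {P : Prog} {s t : ℕ → ℤ} :
    P.Rel s t ↔ ∃ w ∈ P.words, Instr.Run s w t := by
  induction P generalizing s t with
  | skip => simp [Rel, words, Language.mem_one, Instr.Run]
  | instr i =>
    constructor
    · intro h; exact ⟨_, rfl, t, h, rfl⟩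
    · rintro ⟨_, rfl, u, h, rfl⟩; exact h
  | seq P Q ihP ihQ =>
    simp only [Rel, words, Language.mem_mul, ihP, ihQ]
    constructor
    · rintro ⟨u, ⟨v, hv, hu⟩, w, hw, h⟩
      exact ⟨_, ⟨v, hv, w, hw, rfl⟩, Instr.run_append.2 ⟨u, hu, h⟩⟩
    · rintro ⟨_, ⟨v, hv, w, hw, rfl⟩, h⟩
      obtain ⟨u, hu, h⟩ := Instr.run_append.1 h
      exact ⟨u, ⟨v, hv, hu⟩, w, hw, h⟩
  | alt P Q ihP ihQ =>
    simp only [Rel, words, Language.mem_add, ihP, ihQ, or_and_right, exists_or]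
  | star P ih =>
    constructor
    · intro h
      change Relation.ReflTransGen _ _ _ at h
      induction h with
      | refl => exact ⟨[], Language.nil_mem_kstar _, rfl⟩
      | tail _ h ih' =>
        obtain ⟨v, hv, hu⟩ := ih'
        obtain ⟨w, hw, h⟩ := ih.1 h
        obtain ⟨L, rfl, hL⟩ := Language.mem_kstar.1 hv
        refine ⟨L.flatten ++ w, Language.mem_kstar.2 ⟨L ++ [w], by simp, ?_⟩,
          Instr.run_append.2 ⟨_, hu, h⟩⟩
        simp only [List.mem_append, List.mem_singleton]
        rintro y (hy | rfl)
        exacts [hL y hy, hw]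
    · rintro ⟨_, hw, h⟩
      obtain ⟨L, rfl, hL⟩ := Language.mem_kstar.1 hw
      change Relation.ReflTransGen _ _ _
      clear hw
      induction L generalizing s with
      | nil => rw [show t = s from h]
      | cons v L ih' =>
        obtain ⟨u, hu, h⟩ := Instr.run_append.1 h
        exact .head (ih.2 ⟨v, hL _ (by simp), hu⟩) (ih' (fun y hy => hL y (by simp [hy])) h)

theorem exists_mem_words (P : Prog) : ∃ w, w ∈ P.words := by
  induction P with
  | skip => exact ⟨[], rfl⟩
  | instr i => exact ⟨_, rfl⟩
  | seq P Q hP hQ =>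
    obtain ⟨v, hv⟩ := hP
    obtain ⟨w, hw⟩ := hQ
    exact ⟨v ++ w, Language.append_mem_mul hv hw⟩
  | alt P Q hP _ =>
    obtain ⟨v, hv⟩ := hP
    exact ⟨v, Or.inl hv⟩
  | star P _ => exact ⟨[], Language.nil_mem_kstar _⟩

theorem exists_reg_lt (P : Prog) : ∃ R, ∀ w ∈ P.words, ∀ i ∈ w, i.reg < R := by
  induction P with
  | skip => exact ⟨0, by rintro _ rfl i hi; cases hi⟩
  | instr i =>
    refine ⟨i.reg + 1, ?_⟩
    rintro _ rfl j hj
    rw [List.mem_singleton.1 hj]; omega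
  | seq P Q hP hQ =>
    obtain ⟨R, hR⟩ := hP
    obtain ⟨R', hR'⟩ := hQ
    refine ⟨max R R', ?_⟩
    rintro _ ⟨v, hv, w, hw, rfl⟩ i hi
    rcases List.mem_append.1 hi with hi | hi
    · exact lt_max_of_lt_left (hR v hv i hi)
    · exact lt_max_of_lt_right (hR' w hw i hi)
  | alt P Q hP hQ =>
    obtain ⟨R, hR⟩ := hP
    obtain ⟨R', hR'⟩ := hQ
    refine ⟨max R R', ?_⟩
    rintro w (hw | hw) i hi
    · exact lt_max_of_lt_left (hR w hw i hi)
    · exact lt_max_of_lt_right (hR' w hw i hi)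
  | star P hP =>
    obtain ⟨R, hR⟩ := hP
    refine ⟨R, ?_⟩
    rintro _ ⟨L, rfl, hL⟩ i hi
    obtain ⟨v, hv, hi⟩ := List.mem_flatten.1 hi
    exact hR v (hL v hv) i hi

end Prog

/-! ## Operations and tracks -/

/-- The label of an operation of the site `s`: the method is the site, and the argument `k` is the
letter. The letter `2 * r + 2` stands for a unit and `2 * r + 3` for a separator on track `r`,
the letter `0` is an end marker on all tracks, and the letter `1` belongs to no track. -/
def lbl (s k : ℕ) : OpLabel ℕ ℕ := (s, k, 0)

/-- The letter `k` belongs to the track `r`. -/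
def onTrack (r k : ℕ) : Bool := k = 0 || k = 2 * r + 2 || k = 2 * r + 3

/-- The letters of the site `s` on the track `r`. -/
def proj (s r : ℕ) (w : List (OpLabel ℕ ℕ)) : List ℕ :=
  (w.filter fun a => a.1 = s && onTrack r a.2.1).map fun a => a.2.1

theorem proj_append (s r : ℕ) (v w : List (OpLabel ℕ ℕ)) :
    proj s r (v ++ w) = proj s r v ++ proj s r w := by
  simp [proj]

/-- The operations that stand for an instruction: increments happen on site `0`, decrements on
site `1`, and a test for zero puts a separator on both sites. -/
def Instr.code : Instr → List (OpLabel ℕ ℕ)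
  | .inc r => [lbl 0 (2 * r + 2)]
  | .dec r => [lbl 1 (2 * r + 2)]
  | .zero r => [lbl 0 (2 * r + 3), lbl 1 (2 * r + 3)]

theorem replicate_toNat_append_cons (c : ℕ) (z : ℤ) (A B : List ℕ) :
    List.replicate z.toNat c ++ c :: A = List.replicate (-z).toNat c ++ B ↔
      List.replicate (z + 1).toNat c ++ A = List.replicate (-(z + 1)).toNat c ++ B := by
  rcases lt_or_ge z 0 with h | h
  · obtain ⟨n, rfl⟩ : ∃ n : ℕ, z = -(n + 1 : ℕ) := ⟨(-z - 1).toNat, by omega⟩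
    rw [show (-((n + 1 : ℕ) : ℤ)).toNat = 0 by omega,
      show (-(-((n + 1 : ℕ) : ℤ))).toNat = n + 1 by omega,
      show (-((n + 1 : ℕ) : ℤ) + 1).toNat = 0 by omega,
      show (-(-((n + 1 : ℕ) : ℤ) + 1)).toNat = n by omega]
    simp [List.replicate_succ]
  · obtain ⟨n, rfl⟩ : ∃ n : ℕ, z = n := ⟨z.toNat, by omega⟩
    rw [show ((n : ℤ)).toNat = n by omega, show (-(n : ℤ)).toNat = 0 by omega,
      show ((n : ℤ) + 1).toNat = n + 1 by omega, show (-((n : ℤ) + 1)).toNat = 0 by omega,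
      List.replicate_succ']
    simp

theorem replicate_toNat_append_cons_ne {c d : ℕ} (hcd : c ≠ d) (z : ℤ) (A B : List ℕ) :
    List.replicate z.toNat c ++ d :: A = List.replicate (-z).toNat c ++ d :: B ↔
      z = 0 ∧ List.replicate z.toNat c ++ A = List.replicate (-z).toNat c ++ B := by
  rcases lt_trichotomy z 0 with h | rfl | h
  · rw [show z.toNat = 0 by omega,
      show (-z).toNat = ((-z).toNat - 1) + 1 by omega]
    simp [List.replicate_succ, h.ne, hcd.symm]
  · simp
  · rw [show (-z).toNat = 0 by omega,
      show z.toNat = (z.toNat - 1) + 1 by omega]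
    simp [List.replicate_succ, h.ne', hcd]

theorem Instr.run_zero_iff {s : ℕ → ℤ} {w : List Instr} : Instr.Run s w 0 ↔
    ∀ r, List.replicate (s r).toNat (2 * r + 2) ++ proj 0 r (w.flatMap Instr.code) =
      List.replicate (-s r).toNat (2 * r + 2) ++ proj 1 r (w.flatMap Instr.code) := by
  induction w generalizing s with
  | nil =>
    constructor
    · rintro rfl r; simp [proj]
    · intro h
      funext r
      have := congrArg List.length (h r)
      simp [proj] at this
      change 0 = s r
      omega
  | cons i w ih =>
    cases i with
    | inc r' =>
      have : Instr.Run s (.inc r' :: w) 0 ↔ Instr.Run (s + Pi.single r' 1) w 0 := by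
        simp [Instr.Run, Instr.Rel]
      rw [this, ih]
      refine forall_congr' fun r => ?_
      rw [List.flatMap_cons, proj_append, proj_append]
      by_cases hr : r = r'
      · subst hr
        simpa [proj, Instr.code, onTrack, lbl] using
          (replicate_toNat_append_cons (2 * r + 2) (s r) _ _).symm
      · simp [proj, Instr.code, onTrack, lbl, hr, show ¬ r' = r by omega,
          show ¬ 2 * r' = 2 * r + 1 by omega]
    | dec r' =>
      have : Instr.Run s (.dec r' :: w) 0 ↔ Instr.Run (s - Pi.single r' 1) w 0 := by
        simp [Instr.Run, Instr.Rel]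
      rw [this, ih]
      refine forall_congr' fun r => ?_
      rw [List.flatMap_cons, proj_append, proj_append]
      by_cases hr : r = r'
      · subst hr
        have := (replicate_toNat_append_cons (2 * r + 2) (-s r)
          (proj 1 r (w.flatMap Instr.code)) (proj 0 r (w.flatMap Instr.code))).symm
        rw [neg_neg, eq_comm, eq_comm (b := List.replicate (s r).toNat _ ++ _)] at this
        simpa [proj, Instr.code, onTrack, lbl, neg_add_eq_sub] using this
      · simp [proj, Instr.code, onTrack, lbl, hr, show ¬ r' = r by omega,
          show ¬ 2 * r' = 2 * r + 1 by omega]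
    | zero r' =>
      have : Instr.Run s (.zero r' :: w) 0 ↔ s r' = 0 ∧ Instr.Run s w 0 := by
        simp [Instr.Run, Instr.Rel, and_assoc]
      rw [this, ih]
      have key : ∀ r,
          (List.replicate (s r).toNat (2 * r + 2) ++
              proj 0 r ((Instr.zero r' :: w).flatMap Instr.code) =
            List.replicate (-s r).toNat (2 * r + 2) ++
              proj 1 r ((Instr.zero r' :: w).flatMap Instr.code)) ↔
          ((r = r' → s r = 0) ∧
            List.replicate (s r).toNat (2 * r + 2) ++ proj 0 r (w.flatMap Instr.code) =
            List.replicate (-s r).toNat (2 * r + 2) ++ proj 1 r (w.flatMap Instr.code)) := by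
        intro r
        rw [List.flatMap_cons, proj_append, proj_append]
        by_cases hr : r = r'
        · subst hr
          simpa [proj, Instr.code, onTrack, lbl] using
            replicate_toNat_append_cons_ne (show 2 * r + 2 ≠ 2 * r + 3 by omega) (s r) _ _
        · simp [proj, Instr.code, onTrack, lbl, hr, show ¬ r' = r by omega,
            show ¬ 2 * r' + 3 = 2 * r + 2 by omega]
      simp only [key, forall_and, forall_eq]

theorem Instr.run_replicate_inc (s : ℕ → ℤ) (n : ℕ) (w : List Instr) (t : ℕ → ℤ) :
    Instr.Run s (List.replicate n (.inc 0) ++ w) t ↔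
      Instr.Run (s + Pi.single 0 (n : ℤ)) w t := by
  induction n generalizing s with
  | zero => simp
  | succ n ih =>
    rw [List.replicate_succ, List.cons_append]
    simp only [Instr.Run, Instr.Rel, exists_eq_left, ih]
    rw [add_assoc, ← Pi.single_add, add_comm (1 : ℤ)]
    norm_cast

/-- The domain of a partial recursive function in terms of the words of a program. -/
theorem exists_prog_proj_eq_iff_dom {f : ℕ →. ℕ} (h : Nat.Partrec f) :
    ∃ P : Prog, ∀ n : ℕ, (f n).Dom ↔ ∃ w ∈ P.words, ∀ r,
      proj 0 r ((List.replicate n (Instr.inc 0) ++ w).flatMap Instr.code) =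
      proj 1 r ((List.replicate n (Instr.inc 0) ++ w).flatMap Instr.code) := by
  obtain ⟨P, hP⟩ := exists_prog_rel_zero_iff_dom h
  refine ⟨P, fun n => ?_⟩
  rw [← hP, Prog.rel_iff_exists_run]
  refine exists_congr fun w => and_congr_right fun _ => ?_
  have e := Instr.run_replicate_inc 0 n w 0
  rw [zero_add] at e
  rw [← e, Instr.run_zero_iff]
  simp

/-! ## Closure properties of regular languages -/

namespace Language

variable {α β : Type}

/-- The union of a set of languages. -/
def sUnion (T : Set (Language α)) : Language α := {y | ∃ L ∈ T, y ∈ L}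

theorem leftQuotient_cons_mul (A L : Language α) (a : α) :
    (A * L).leftQuotient [a] =
      A.leftQuotient [a] * L + sUnion {M | [] ∈ A ∧ M = L.leftQuotient [a]} := by
  ext y
  simp only [mem_leftQuotient, mem_add, mem_mul]
  constructor
  · rintro ⟨u, hu, v, hv, huv⟩
    cases u with
    | nil => exact Or.inr ⟨_, ⟨hu, rfl⟩, by
      rw [List.nil_append] at huv; rw [mem_leftQuotient, ← huv]; exact hv⟩
    | cons c u =>
      simp only [List.cons_append, List.nil_append, List.cons.injEq] at huv
      obtain ⟨rfl, rfl⟩ := huv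
      exact Or.inl ⟨u, hu, v, hv, rfl⟩
  · rintro (⟨u, hu, v, hv, rfl⟩ | ⟨_, ⟨h, rfl⟩, h'⟩)
    · exact ⟨a :: u, hu, v, hv, rfl⟩
    · exact ⟨[], h, _, h', rfl⟩

theorem IsRegular.mul {L L' : Language α} (h : L.IsRegular) (h' : L'.IsRegular) :
    (L * L').IsRegular := by
  refine .of_finite_range_leftQuotient (Set.Finite.subset (Set.Finite.image2
    (fun (A : Language α) (T : Set (Language α)) => A * L' + sUnion T)
    h.finite_range_leftQuotient h'.finite_range_leftQuotient.powerset) ?_)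
  rintro _ ⟨x, rfl⟩
  induction x using List.reverseRecOn with
  | nil =>
    refine ⟨_, ⟨[], rfl⟩, ∅, Set.empty_subset _, ?_⟩
    ext y
    constructor
    · rintro (h | ⟨_, h, _⟩)
      exacts [h, absurd h (Set.notMem_empty _)]
    · intro h
      exact Or.inl h
  | append_singleton x a ih =>
    obtain ⟨_, ⟨u, rfl⟩, T, hT, h⟩ := ih
    refine ⟨_, ⟨u ++ [a], rfl⟩,
      {M | ([] ∈ L.leftQuotient u ∧ M = L'.leftQuotient [a]) ∨ ∃ N ∈ T, M = N.leftQuotient [a]},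
      ?_, ?_⟩
    · rintro M (⟨_, rfl⟩ | ⟨N, hN, rfl⟩)
      · exact ⟨_, rfl⟩
      · obtain ⟨v, rfl⟩ := hT hN
        exact ⟨v ++ [a], leftQuotient_append _ _ _⟩
    · dsimp only
      rw [leftQuotient_append (x := x), ← h, leftQuotient_append (x := u)]
      have : ∀ A B : Language α,
          (A + B).leftQuotient [a] = A.leftQuotient [a] + B.leftQuotient [a] := fun _ _ => rfl
      rw [this, leftQuotient_cons_mul, add_assoc]
      congr 1
      ext y
      simp only [sUnion]
      constructor
      · rintro ⟨M, ⟨h, rfl⟩ | ⟨N, hN, rfl⟩, hy⟩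
        · exact Or.inl ⟨_, ⟨h, rfl⟩, hy⟩
        · exact Or.inr ⟨N, hN, hy⟩
      · rintro (⟨_, ⟨h, rfl⟩, hy⟩ | ⟨N, hN, hy⟩)
        · exact ⟨_, Or.inl ⟨h, rfl⟩, hy⟩
        · exact ⟨_, Or.inr ⟨N, hN, rfl⟩, hy⟩

theorem leftQuotient_kstar (L : Language α) (a : α) :
    (L∗).leftQuotient [a] = L.leftQuotient [a] * L∗ := by
  ext y
  constructor
  · intro h
    rw [mem_leftQuotient, kstar_def_nonempty] at h
    obtain ⟨S, hS, h⟩ := h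
    cases S with
    | nil => simp at hS
    | cons v S =>
      obtain ⟨hv, hv'⟩ := h v (by simp)
      cases v with
      | nil => exact absurd rfl hv'
      | cons c v =>
        simp only [List.flatten_cons, List.cons_append, List.nil_append,
          List.cons.injEq] at hS
        obtain ⟨rfl, rfl⟩ := hS
        exact ⟨v, hv, _, join_mem_kstar fun w hw => (h w (by simp [hw])).1, rfl⟩
  · rintro ⟨v, hv, w, hw, rfl⟩
    obtain ⟨S, rfl, hS⟩ := mem_kstar.1 hw
    refine mem_kstar.2 ⟨([a] ++ v) :: S, by simp, ?_⟩
    rintro w hw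
    rcases List.mem_cons.1 hw with rfl | hw
    exacts [hv, hS w hw]

theorem IsRegular.kstar {L : Language α} (h : L.IsRegular) : (L∗).IsRegular := by
  refine .of_finite_range_leftQuotient (Set.Finite.subset (Set.Finite.insert (L∗)
    (h.finite_range_leftQuotient.powerset.image fun T => sUnion T * L∗)) ?_)
  rintro _ ⟨x, rfl⟩
  induction x using List.reverseRecOn with
  | nil => exact Or.inl rfl
  | append_singleton x a ih =>
    right
    rw [leftQuotient_append]
    rcases ih with h | ⟨T, hT, h⟩
    · refine ⟨{L.leftQuotient [a]}, by rintro _ rfl; exact ⟨_, rfl⟩, ?_⟩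
      dsimp only
      rw [h, leftQuotient_kstar]
      congr 1
      ext y
      constructor
      · rintro ⟨_, rfl, h⟩; exact h
      · intro h; exact ⟨_, rfl, h⟩
    · refine ⟨{M | ([] ∈ sUnion T ∧ M = L.leftQuotient [a]) ∨ ∃ N ∈ T, M = N.leftQuotient [a]},
        ?_, ?_⟩
      · rintro M (⟨_, rfl⟩ | ⟨N, hN, rfl⟩)
        · exact ⟨_, rfl⟩
        · obtain ⟨v, rfl⟩ := hT hN
          exact ⟨v ++ [a], leftQuotient_append _ _ _⟩
      · dsimp only at h ⊢
        rw [← h, leftQuotient_cons_mul, leftQuotient_kstar]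
        ext y
        constructor
        · rintro ⟨u, ⟨M, ⟨h, rfl⟩ | ⟨N, hN, rfl⟩, hu⟩, v, hv, rfl⟩
          · exact Or.inr ⟨_, ⟨h, rfl⟩, u, hu, v, hv, rfl⟩
          · exact Or.inl ⟨u, ⟨N, hN, hu⟩, v, hv, rfl⟩
        · rintro (⟨u, ⟨N, hN, hu⟩, v, hv, rfl⟩ | ⟨_, ⟨h, rfl⟩, u, hu, v, hv, rfl⟩)
          · exact ⟨u, ⟨_, Or.inr ⟨N, hN, rfl⟩, hu⟩, v, hv, rfl⟩
          · exact ⟨u, ⟨_, Or.inl ⟨h, rfl⟩, hu⟩, v, hv, rfl⟩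

theorem isRegular_singleton (x : List α) : ({x} : Language α).IsRegular := by
  refine .of_finite_range_leftQuotient (Set.Finite.subset
    (Set.Finite.insert 0 ((List.finite_toSet (x.tails)).image fun y => ({y} : Language α))) ?_)
  rintro _ ⟨u, rfl⟩
  by_cases hu : u <+: x
  · obtain ⟨v, rfl⟩ := hu
    refine Or.inr ⟨v, by simp, ?_⟩
    ext y
    change y = v ↔ u ++ y = u ++ v
    simp
  · left
    ext y
    refine ⟨fun h => absurd ⟨y, h⟩ hu, fun h => absurd h (notMem_zero y)⟩

/-- The prefixes of the words of a language. -/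
def prefixes (L : Language α) : Language α := {x | ∃ w ∈ L, x <+: w}

theorem IsRegular.prefixes {L : Language α} (h : L.IsRegular) : L.prefixes.IsRegular := by
  refine .of_finite_range_leftQuotient
    (Set.Finite.subset (h.finite_range_leftQuotient.image Language.prefixes) ?_)
  rintro _ ⟨u, rfl⟩
  refine ⟨_, ⟨u, rfl⟩, ?_⟩
  ext y
  constructor
  · rintro ⟨w, hw, hy⟩
    exact ⟨u ++ w, hw, (List.prefix_append_right_inj u).2 hy⟩
  · rintro ⟨w, hw, v, hv⟩
    exact ⟨y ++ v, by simpa [mem_leftQuotient, ← List.append_assoc, hv] using hw, v, rfl⟩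

/-- The image of a language under a substitution of words for letters. -/
def subst (L : Language α) (f : α → List β) : Language β := {x | ∃ w ∈ L, w.flatMap f = x}

end Language

theorem Prog.isRegular_subst_words {β : Type} (f : Instr → List β) (P : Prog) :
    (P.words.subst f).IsRegular := by
  induction P with
  | skip =>
    convert Language.isRegular_singleton ([] : List β)
    ext x
    constructor
    · rintro ⟨_, rfl, rfl⟩; rfl
    · rintro rfl; exact ⟨_, rfl, rfl⟩
  | instr i =>
    convert Language.isRegular_singleton (f i)
    ext x
    constructor
    · rintro ⟨_, rfl, rfl⟩; change _ = _; simp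
    · rintro rfl; exact ⟨_, rfl, by simp⟩
  | seq P Q hP hQ =>
    convert hP.mul hQ
    ext x
    constructor
    · rintro ⟨_, ⟨u, hu, v, hv, rfl⟩, rfl⟩
      exact ⟨_, ⟨u, hu, rfl⟩, _, ⟨v, hv, rfl⟩, List.flatMap_append.symm⟩
    · rintro ⟨_, ⟨u, hu, rfl⟩, _, ⟨v, hv, rfl⟩, rfl⟩
      exact ⟨_, ⟨u, hu, v, hv, rfl⟩, List.flatMap_append⟩
  | alt P Q hP hQ =>
    convert hP.add hQ
    ext x
    constructor
    · rintro ⟨w, hw | hw, h⟩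
      exacts [Or.inl ⟨w, hw, h⟩, Or.inr ⟨w, hw, h⟩]
    · rintro (⟨w, hw, h⟩ | ⟨w, hw, h⟩)
      exacts [⟨w, Or.inl hw, h⟩, ⟨w, Or.inr hw, h⟩]
  | star P hP =>
    convert hP.kstar
    ext x
    constructor
    · rintro ⟨_, ⟨S, rfl, hS⟩, rfl⟩
      refine ⟨S.map fun w => w.flatMap f, ?_, ?_⟩
      · induction S with
        | nil => rfl
        | cons v S ih => simp [ih fun y hy => hS y (by simp [hy])]
      · intro y hy
        obtain ⟨w, hw, rfl⟩ := List.mem_map.1 hy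
        exact ⟨w, hS w hw, rfl⟩
    · rintro ⟨S, rfl, hS⟩
      induction S with
      | nil => exact ⟨[], Language.nil_mem_kstar _, rfl⟩
      | cons v S ih =>
        obtain ⟨w, ⟨S', rfl, hS'⟩, hw⟩ := ih fun y hy => hS y (by simp [hy])
        obtain ⟨u, hu, rfl⟩ := hS v (by simp)
        refine ⟨u ++ S'.flatten, ⟨u :: S', rfl, ?_⟩, by simp [← hw]⟩
        intro y hy
        rcases List.mem_cons.1 hy with rfl | hy
        exacts [hu, hS' y hy]

/-! ## Finite automata as lists -/

namespace FinAutomaton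

variable {A : Type}

/-- The word `w` is accepted from the state `q`. -/
def Acc (T : List (ℕ × A × ℕ)) (F : List ℕ) : ℕ → List A → Prop
  | q, [] => q ∈ F
  | q, a :: w => ∃ r, (q, a, r) ∈ T ∧ Acc T F r w

theorem mem_language {𝒜 : FinAutomaton A} {w : List A} :
    w ∈ 𝒜.language ↔ ∃ q ∈ 𝒜.1, Acc 𝒜.2.1 𝒜.2.2 q w := by
  have : ∀ Q : Set ℕ, w ∈ 𝒜.toNFA.acceptsFrom Q ↔ ∃ q ∈ Q, Acc 𝒜.2.1 𝒜.2.2 q w := by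
    induction w with
    | nil => exact fun Q => NFA.nil_mem_acceptsFrom _
    | cons a w ih =>
      intro Q
      rw [NFA.cons_mem_acceptsFrom, ih]
      constructor
      · rintro ⟨r, hr, h⟩
        obtain ⟨q, hq, hr⟩ := (NFA.mem_stepSet).1 hr
        exact ⟨q, hq, r, hr, h⟩
      · rintro ⟨q, hq, r, hr, h⟩
        exact ⟨r, (NFA.mem_stepSet).2 ⟨q, hq, hr⟩, h⟩
  exact this _

section OfDFA

variable {σ : Type} [Fintype σ] (M : DFA A σ) (Λ : List A) (ι : σ → ℕ)

/-- The transitions of a deterministic automaton with letters from a finite list. -/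
noncomputable def transitions : List (ℕ × A × ℕ) :=
  Finset.univ.toList.flatMap fun q => Λ.map fun a => (ι q, a, ι (M.step q a))

open Classical in
/-- The numbers of the accepting states of a deterministic automaton. -/
noncomputable def accepting : List ℕ :=
  (Finset.univ.filter (· ∈ M.accept)).toList.map ι

variable {M Λ ι}

theorem mem_transitions {x : ℕ × A × ℕ} :
    x ∈ transitions M Λ ι ↔ ∃ q, ∃ a ∈ Λ, (ι q, a, ι (M.step q a)) = x := by
  simp [transitions]

theorem mem_accepting {n : ℕ} : n ∈ accepting M ι ↔ ∃ q ∈ M.accept, ι q = n := by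
  simp [accepting]

theorem acc_iff_of_extends (hι : Function.Injective ι) {T : List (ℕ × A × ℕ)} {F : List ℕ}
    (hT : ∀ q a r, (ι q, a, r) ∈ T ↔ (ι q, a, r) ∈ transitions M Λ ι)
    (hF : ∀ q, ι q ∈ F ↔ ι q ∈ accepting M ι) {q : σ} {w : List A} :
    Acc T F (ι q) w ↔ w ∈ M.acceptsFrom q ∧ ∀ a ∈ w, a ∈ Λ := by
  induction w generalizing q with
  | nil =>
    change ι q ∈ F ↔ q ∈ M.accept ∧ _
    simp [hF, mem_accepting, hι.eq_iff]
  | cons a w ih =>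
    simp only [Acc, hT, mem_transitions, Prod.mk.injEq, hι.eq_iff]
    have h1 : a :: w ∈ M.acceptsFrom q ↔ w ∈ M.acceptsFrom (M.step q a) := Iff.rfl
    rw [h1]
    constructor
    · rintro ⟨_, ⟨q, a, ha, rfl, rfl, rfl⟩, h⟩
      obtain ⟨h, h'⟩ := ih.1 h
      exact ⟨h, List.forall_mem_cons.2 ⟨ha, h'⟩⟩
    · rintro ⟨h, h'⟩
      obtain ⟨ha, h'⟩ := List.forall_mem_cons.1 h'
      exact ⟨_, ⟨q, a, ha, rfl, rfl, rfl⟩, ih.2 ⟨h, h'⟩⟩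

end OfDFA

/-- A regular language, restricted to words over a finite alphabet, has a finite automaton. -/
theorem exists_language_eq {L : Language A} (h : L.IsRegular) (Λ : List A) :
    ∃ 𝒜 : FinAutomaton A, 𝒜.language = {w | w ∈ L ∧ ∀ a ∈ w, a ∈ Λ} := by
  obtain ⟨σ, _, M, rfl⟩ := h
  let ι : σ → ℕ := fun q => Fintype.equivFin σ q
  have hι : Function.Injective ι := Fin.val_injective.comp (Fintype.equivFin σ).injective
  refine ⟨([ι M.start], transitions M Λ ι, accepting M ι), ?_⟩
  ext w
  rw [mem_language]
  simp only [List.mem_singleton, exists_eq_left]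
  exact acc_iff_of_extends hι (fun _ _ _ => Iff.rfl) fun _ => Iff.rfl

theorem exists_computable_language_prefixes [Primcodable A] {L : Language A} (h : L.IsRegular)
    (hne : ∃ w, w ∈ L) {Λ : List A} (hΛ : ∀ w ∈ L, ∀ a ∈ w, a ∈ Λ) (a : A) :
    ∃ g : ℕ → FinAutomaton A, Computable g ∧ ∀ n x,
      x ∈ (g n).language ↔ ∃ w ∈ L, x <+: List.replicate n a ++ w := by
  classical
  obtain ⟨σ, _, M, hM⟩ := h.prefixes
  let K := Fintype.card σ
  let ι : σ → ℕ := fun q => if q = M.start then K else Fintype.equivFin σ q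
  have hlt : ∀ q : σ, (Fintype.equivFin σ q : ℕ) < K := fun q => (Fintype.equivFin σ q).2
  have hle : ∀ q, ι q ≤ K := by
    intro q
    dsimp only [ι]
    split_ifs
    exacts [le_rfl, (hlt q).le]
  have hstart : ι M.start = K := by simp [ι]
  have hι : Function.Injective ι := by
    intro p q hpq
    dsimp only [ι] at hpq
    split_ifs at hpq with h1 h2 h2
    · rw [h1, h2]
    · exact absurd hpq (hlt q).ne'
    · exact absurd hpq (hlt p).ne
    · exact (Fintype.equivFin σ).injective (Fin.val_injective hpq)
  let T := transitions M Λ ι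
  let F := accepting M ι
  let g : ℕ → FinAutomaton A := fun n => ([K + n],
    T ++ (List.range n).map (fun j => (K + j + 1, a, K + j)),
    F ++ (List.range n).map (fun j => K + j + 1))
  have hTK : ∀ p b r, (p, b, r) ∈ T → p ≤ K := by
    intro p b r hp
    obtain ⟨q, _, _, hq⟩ := mem_transitions.1 hp
    obtain rfl := (Prod.mk.inj hq).1
    exact hle q
  have hFK : ∀ p ∈ F, p ≤ K := by
    intro p hp
    obtain ⟨q, _, rfl⟩ := mem_accepting.1 hp
    exact hle q
  refine ⟨g, ?_, fun n x => ?_⟩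
  · have hadd : Primrec₂ fun (_ j : ℕ) => K + j :=
      (Primrec.nat_add.comp (Primrec.const K) Primrec.snd)
    have hadd1 : Primrec₂ fun (_ j : ℕ) => K + j + 1 := Primrec.succ.comp hadd
    have h1 : Primrec fun n : ℕ => [K + n] :=
      Primrec.list_cons.comp (Primrec.nat_add.comp (Primrec.const K) Primrec.id)
        (Primrec.const [])
    have h2 : Primrec fun n : ℕ => T ++ (List.range n).map (fun j => (K + j + 1, a, K + j)) :=
      Primrec.list_append.comp (Primrec.const T) (Primrec.list_map Primrec.list_range
        (Primrec.pair hadd1 (Primrec.pair (Primrec.const a) hadd)))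
    have h3 : Primrec fun n : ℕ => F ++ (List.range n).map (fun j => K + j + 1) :=
      Primrec.list_append.comp (Primrec.const F) (Primrec.list_map Primrec.list_range hadd1)
    exact (Primrec.pair h1 (Primrec.pair h2 h3)).to_comp
  · have key : ∀ j ≤ n, ∀ x, Acc (g n).2.1 (g n).2.2 (K + j) x ↔
        ∃ w ∈ L, x <+: List.replicate j a ++ w := by
      intro j
      induction j with
      | zero =>
        intro _ x
        rw [Nat.add_zero, ← hstart, acc_iff_of_extends hι (M := M) (Λ := Λ)]
        · change x ∈ M.accepts ∧ _ ↔ _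
          rw [hM]
          constructor
          · exact fun h => h.1
          · rintro ⟨w, hw, hx⟩
            exact ⟨⟨w, hw, hx⟩, fun a ha => hΛ w hw a (hx.subset ha)⟩
        · intro q b r
          have := hle q
          simp only [g, List.mem_append, List.mem_map, Prod.mk.injEq]
          refine or_iff_left ?_
          rintro ⟨j, _, hj, _⟩
          omega
        · intro q
          have := hle q
          simp only [g, List.mem_append, List.mem_map]
          refine or_iff_left ?_
          rintro ⟨j, _, hj⟩
          omega
      | succ j ih =>
        intro hj x
        cases x with
        | nil =>
          obtain ⟨w, hw⟩ := hne
          refine iff_of_true ?_ ⟨w, hw, List.nil_prefix⟩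
          change K + (j + 1) ∈ _ ++ _
          exact List.mem_append_right _ (List.mem_map.2 ⟨j, List.mem_range.2 (by omega), rfl⟩)
        | cons b x =>
          simp only [List.replicate_succ, List.cons_append, List.cons_prefix_cons]
          have : ∀ r, (K + (j + 1), b, r) ∈ (g n).2.1 ↔ b = a ∧ r = K + j := by
            intro r
            simp only [g, List.mem_append, List.mem_map, List.mem_range, Prod.mk.injEq]
            constructor
            · rintro (h | ⟨i, hi, h1, h2, h3⟩)
              · have := hTK _ _ _ h
                omega
              · exact ⟨h2.symm, by omega⟩
            · rintro ⟨rfl, rfl⟩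
              exact Or.inr ⟨j, by omega, by omega, rfl, rfl⟩
          simp only [Acc, this]
          constructor
          · rintro ⟨_, ⟨rfl, rfl⟩, h⟩
            obtain ⟨w, hw, h⟩ := (ih (by omega) x).1 h
            exact ⟨w, hw, rfl, h⟩
          · rintro ⟨w, hw, rfl, h⟩
            exact ⟨_, ⟨rfl, rfl⟩, (ih (by omega) x).2 ⟨w, hw, h⟩⟩
    rw [mem_language]
    simp only [show (g n).1 = [K + n] from rfl, List.mem_singleton, exists_eq_left]
    exact key n le_rfl x

end FinAutomaton

/-! ## Detecting a difference between the sites -/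

/-- The kind of a letter that belongs to the track `r`. -/
def kind (r k : ℕ) : Fin 3 := if k = 0 then 0 else if k = 2 * r + 2 then 1 else 2

theorem kind_inj {r k k' : ℕ} (h : onTrack r k) (h' : onTrack r k') :
    kind r k = kind r k' ↔ k = k' := by
  simp only [onTrack, Bool.or_eq_true, decide_eq_true_eq] at h h'
  refine ⟨fun e => ?_, fun e => e ▸ rfl⟩
  unfold kind at e
  split_ifs at e <;> omega

/-- The states of the detector of a track: the sites agree so far, site `0` is one letter ahead,
the sites differ, or the operations do not alternate. -/
inductive Det where
  | eq
  | lead (x : Fin 3)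
  | bad
  | dead

instance : Finite Det :=
  Finite.of_injective (β := Option (Fin 3) × Bool)
    (fun | .eq => (none, true) | .lead x => (some x, true) | .bad => (none, false)
         | .dead => (some 0, false))
    (by rintro (_ | x | _ | _) (_ | y | _ | _) <;> simp)

namespace Det

/-- The detector reads a letter of site `0`. -/
def left (x : Fin 3) : Det → Det
  | eq => lead x
  | bad => bad
  | _ => dead

/-- The detector reads a letter of site `1`. -/
def right (y : Fin 3) : Det → Det
  | lead x => if x = y then eq else bad
  | bad => bad
  | _ => dead

/-- The detector of the track `r` reads an operation. -/
def step (r : ℕ) (d : Det) (a : OpLabel ℕ ℕ) : Det :=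
  if onTrack r a.2.1 then
    if a.1 = 0 then d.left (kind r a.2.1) else if a.1 = 1 then d.right (kind r a.2.1) else d
  else d

theorem step_bad (r : ℕ) (a : OpLabel ℕ ℕ) : step r bad a = bad := by
  simp [step, left, right]

theorem step_dead (r : ℕ) (a : OpLabel ℕ ℕ) : step r dead a = dead := by
  simp [step, left, right]

theorem foldl_bad (r : ℕ) (w : List (OpLabel ℕ ℕ)) : w.foldl (step r) bad = bad := by
  induction w with
  | nil => rfl
  | cons a w ih => rw [List.foldl_cons, step_bad, ih]

theorem foldl_dead (r : ℕ) (w : List (OpLabel ℕ ℕ)) : w.foldl (step r) dead = dead := by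
  induction w with
  | nil => rfl
  | cons a w ih => rw [List.foldl_cons, step_dead, ih]

theorem proj_ne_of_foldl_eq_bad {r : ℕ} {w : List (OpLabel ℕ ℕ)} :
    (w.foldl (step r) eq = bad → proj 0 r w ≠ proj 1 r w) ∧
    ∀ k, onTrack r k → w.foldl (step r) (lead (kind r k)) = bad →
      k :: proj 0 r w ≠ proj 1 r w := by
  induction w with
  | nil => exact ⟨fun h => by simp at h, fun _ _ h => by simp at h⟩
  | cons a w ih =>
    obtain ⟨s, k, rv⟩ := a
    have hp : ∀ s', proj s' r ((s, k, rv) :: w) =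
        if s = s' ∧ onTrack r k then k :: proj s' r w else proj s' r w := by
      intro s'
      simp only [proj, List.filter_cons]
      by_cases h : s = s' <;> by_cases h' : onTrack r k <;> simp [h, h']
    rw [hp, hp, List.foldl_cons]
    by_cases hk : onTrack r k
    · by_cases h0 : s = 0
      · subst h0
        simp only [step, hk, if_true, left, List.foldl_cons, foldl_dead]
        simp only [true_and, zero_ne_one, false_and, if_false, if_true]
        exact ⟨fun h => ih.2 k hk h, fun _ _ h => by simp at h⟩
      · by_cases h1 : s = 1
        · subst h1
          simp only [step, hk, if_true, right, List.foldl_cons]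
          simp only [one_ne_zero, false_and, if_false, true_and, if_true]
          refine ⟨fun h => by simp [foldl_dead] at h, fun k' hk' h => ?_⟩
          simp only [kind_inj hk' hk] at h
          by_cases e : k' = k
          · subst e
            simpa using ih.1 (by simpa using h)
          · simp [e]
        · simpa [step, hk, h0, h1] using ih
    · simpa [step, hk] using ih

theorem exists_interleaving {ι : Type} (l : ι → OpLabel ℕ ℕ) (r : ℕ) :
    ∀ u v : List ι, (∀ x ∈ u, (l x).1 = 0) → (∀ x ∈ v, (l x).1 = 1) →
    ¬ proj 0 r (u.map l) <+: proj 1 r (v.map l) →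
    ¬ proj 1 r (v.map l) <+: proj 0 r (u.map l) →
    ∃ w : List ι, w.filter (fun x => (l x).1 = 0) = u ∧ w.filter (fun x => (l x).1 = 1) = v ∧
      (∀ x ∈ w, x ∈ u ∨ x ∈ v) ∧ (w.map l).foldl (step r) eq = bad := by
  have hp : ∀ s x (u : List ι), proj s r ((x :: u).map l) =
      if (l x).1 = s ∧ onTrack r (l x).2.1 then (l x).2.1 :: proj s r (u.map l)
      else proj s r (u.map l) := by
    intro s x u
    simp only [proj, List.map_cons, List.filter_cons]
    by_cases h : (l x).1 = s <;> by_cases h' : onTrack r (l x).2.1 <;> simp [h, h']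
  intro u
  induction u with
  | nil => intro v _ _ h _; exact absurd List.nil_prefix h
  | cons x u ihu =>
    intro v hu hv h h'
    obtain ⟨hx, hu⟩ := List.forall_mem_cons.1 hu
    by_cases kx : onTrack r (l x).2.1
    · induction v with
      | nil => exact absurd List.nil_prefix h'
      | cons y v ihv =>
        obtain ⟨hy, hv⟩ := List.forall_mem_cons.1 hv
        by_cases ky : onTrack r (l y).2.1
        · have hpx := hp 0 x u
          have hpy := hp 1 y v
          rw [if_pos ⟨hx, kx⟩] at hpx
          rw [if_pos ⟨hy, ky⟩] at hpy
          rw [hpx, hpy, List.cons_prefix_cons] at h h'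
          by_cases e : (l x).2.1 = (l y).2.1
          · obtain ⟨w, rfl, rfl, hw, hw'⟩ := ihu v hu hv (fun h1 => h ⟨e, h1⟩)
              (fun h1 => h' ⟨e.symm, h1⟩)
            refine ⟨x :: y :: w, by simp [hx, hy], by simp [hx, hy], ?_, ?_⟩
            · intro z hz
              simp only [List.mem_cons] at hz ⊢
              rcases hz with rfl | rfl | hz
              · simp
              · simp
              · rcases hw z hz with h | h <;> simp [h]
            · simp [step, ky, hx, hy, left, right, e, hw']
          · have hu0 : u.filter (fun x => (l x).1 = 0) = u :=
              List.filter_eq_self.2 (by simpa using hu)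
            have hu1 : u.filter (fun x => (l x).1 = 1) = [] :=
              List.filter_eq_nil_iff.2 (by intro z hz; simp [hu z hz])
            have hv0 : v.filter (fun x => (l x).1 = 0) = [] :=
              List.filter_eq_nil_iff.2 (by intro z hz; simp [hv z hz])
            have hv1 : v.filter (fun x => (l x).1 = 1) = v :=
              List.filter_eq_self.2 (by simpa using hv)
            refine ⟨x :: y :: (u ++ v), ?_, ?_, ?_, ?_⟩
            · rw [List.filter_cons, List.filter_cons, List.filter_append, hu0, hv0]
              simp [hx, hy]
            · rw [List.filter_cons, List.filter_cons, List.filter_append, hu1, hv1]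
              simp [hx, hy]
            · intro z hz
              simp only [List.mem_cons, List.mem_append] at hz ⊢
              tauto
            · have e' := mt (kind_inj kx ky).1 e
              simp only [List.map_cons, List.foldl_cons]
              rw [show step r (step r eq (l x)) (l y) = bad by
                simp [step, kx, ky, hx, hy, left, right, e'], foldl_bad]
        · have hpy := hp 1 y v
          rw [if_neg (fun h => ky h.2)] at hpy
          rw [hpy] at h h'
          obtain ⟨w, hw0, hw1, hw, hw'⟩ := ihv hv h h'
          refine ⟨y :: w, by simp [hy, hw0], by simp [hy, hw1], ?_, ?_⟩
          · intro z hz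
            rcases List.mem_cons.1 hz with rfl | hz
            · simp
            · rcases hw z hz with h | h
              · exact Or.inl h
              · exact Or.inr (List.mem_cons_of_mem _ h)
          · simpa [step, ky] using hw'
    · have hpx := hp 0 x u
      rw [if_neg (fun h => kx h.2)] at hpx
      rw [hpx] at h h'
      obtain ⟨w, hw0, hw1, hw, hw'⟩ := ihu v hu hv h h'
      refine ⟨x :: w, by simp [hx, hw0], by simp [hx, hw1], ?_, ?_⟩
      · intro z hz
        rcases List.mem_cons.1 hz with rfl | hz
        · simp
        · rcases hw z hz with h | h
          · exact Or.inl (List.mem_cons_of_mem _ h)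
          · exact Or.inr h
      · simpa [step, kx] using hw'

end Det

/-! ## The specification -/

/-- The words without the final operation `lbl 0 1`, and those in which site `1` has ended and the
two sites differ on some track. -/
def specLanguage (R : ℕ) : Language (OpLabel ℕ ℕ) :=
  {w | (∀ a ∈ w, ¬ (a.1 = 0 ∧ a.2.1 = 1)) ∨ ((∃ a ∈ w, a.1 = 1 ∧ a.2.1 = 0) ∧
    ∃ r < R, w.foldl (Det.step r) .eq = .bad)}

/-- An automaton for `specLanguage R`. -/
def specDFA (R : ℕ) : DFA (OpLabel ℕ ℕ) ((Fin R → Det) × Bool × Bool) where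
  step q a := (fun r => (q.1 r).step r a, q.2.1 || (a.1 = 1 && a.2.1 = 0),
    q.2.2 || (a.1 = 0 && a.2.1 = 1))
  start := (fun _ => .eq, false, false)
  accept := {q | q.2.2 = false ∨ (q.2.1 = true ∧ ∃ r, q.1 r = .bad)}

theorem specLanguage_isRegular (R : ℕ) : (specLanguage R).IsRegular := by
  refine ⟨_, Fintype.ofFinite _, specDFA R, ?_⟩
  have : ∀ (w : List (OpLabel ℕ ℕ)) q, (specDFA R).evalFrom q w =
      (fun r : Fin R => w.foldl (Det.step r) (q.1 r), q.2.1 || w.any (fun a => a.1 = 1 && a.2.1 = 0),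
        q.2.2 || w.any (fun a => a.1 = 0 && a.2.1 = 1)) := by
    intro w
    induction w with
    | nil => intro q; simp
    | cons a w ih =>
      intro q
      rw [DFA.evalFrom_cons, ih]
      simp [specDFA, Bool.or_assoc]
  ext w
  rw [DFA.mem_accepts, DFA.eval, this]
  simp only [specDFA, specLanguage, Set.mem_ofPred_eq, Bool.false_or]
  refine or_congr ?_ (and_congr ?_ ?_)
  · simp
  · simp
  · exact ⟨fun ⟨r, hr⟩ => ⟨r, r.2, hr⟩, fun ⟨r, h, hr⟩ => ⟨⟨r, h⟩, hr⟩⟩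

/-! ## Explaining histories -/

namespace History

variable {M D : Type} {h : History M D} {S : Spec M D}

theorem Explained.mono {r r' : h.Op → h.Op → Prop} {hr : IsStrictPO r} {hr' : IsStrictPO r'}
    (hrr : ∀ a b, r a b → r' a b) {A K : Set h.Op} (H : h.Explained S r' hr' A K) :
    h.Explained S r hr A K := by
  obtain ⟨ρ, hρ, h1, h2⟩ := H
  exact ⟨ρ, hρ, fun a b hab => h1 a b (hrr _ _ hab), h2⟩

theorem Explained.exists_list {r : h.Op → h.Op → Prop} {hr : IsStrictPO r} {A K : Set h.Op}
    (H : h.Explained S r hr A K) : ∃ w ∈ S, ∃ E : List h.Op, E.Nodup ∧ (∀ x, x ∈ E ↔ x ∈ A) ∧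
      E.Pairwise (fun a b => ¬ r b a) ∧
      E.map (fun x => ((h.label x).1, (h.label x).2.1)) = w.map fun a => (a.1, a.2.1) := by
  obtain ⟨ρ, ⟨w, hw, e, he, hl⟩, h1, h2⟩ := H
  refine ⟨w, hw, List.ofFn fun i => (e i : h.Op), ?_, ?_, ?_, ?_⟩
  · exact List.nodup_ofFn.2 (Subtype.val_injective.comp e.injective)
  · intro x
    rw [List.mem_ofFn]
    constructor
    · rintro ⟨i, rfl⟩; exact (e i).2
    · intro hx; exact ⟨e.symm ⟨x, hx⟩, by simp⟩
  · rw [List.pairwise_ofFn]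
    intro i j hij hr
    exact lt_asymm hij ((he j i).1 (h1 _ _ hr))
  · refine List.ext_getElem (by simp) fun i hi hi' => ?_
    simp only [List.getElem_map, List.getElem_ofFn]
    have hi'' : i < w.length := by simpa using hi'
    have e1 : ρ.label (e ⟨i, hi''⟩) = w[i] := hl ⟨i, hi''⟩
    have e2 := h2 (e ⟨i, hi''⟩)
    rw [← e1]
    generalize e ⟨i, hi''⟩ = o at e2
    simp only [LPoset.full, LPoset.keepReturns, restrict] at e2
    rcases e2 with e2 | ⟨m, arg, rv, e2, e3⟩
    · split_ifs at e2 <;> simp_all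
    · split_ifs at e3 <;> simp_all

theorem explained_of_list {r : h.Op → h.Op → Prop} {hr : IsStrictPO r} {A : Set h.Op}
    {E : List h.Op} (hE : E.Nodup) (hA : ∀ x, x ∈ E ↔ x ∈ A) (hEr : E.Pairwise r)
    (hS : E.map h.label ∈ S) (K : Set h.Op) : h.Explained S r hr A K := by
  classical
  refine ⟨h.restrict r hr A, ⟨_, hS, (finCongr (List.length_map _)).trans
    ((List.Nodup.getEquiv E hE).trans (Equiv.subtypeEquivRight hA)), ?_, ?_⟩, ?_, ?_⟩
  · have key : ∀ i j : Fin E.length, i < j → r (E.get i) (E.get j) :=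
      List.pairwise_iff_get.1 hEr
    intro i j
    refine ⟨fun hij => ?_, fun hij => key _ _ hij⟩
    by_contra hlt
    rcases lt_or_eq_of_le (not_lt.1 hlt) with h' | rfl
    · exact hr.1 _ (hr.2 _ _ _ hij (key (finCongr (List.length_map _) j)
        (finCongr (List.length_map _) i) h'))
    · exact hr.1 _ hij
  · intro i
    simp [restrict]
  · exact fun _ _ hab => hab
  · intro o
    simp only [LPoset.full, LPoset.keepReturns]
    split_ifs
    · exact Or.inl rfl
    · exact Or.inr ⟨_, _, _, rfl, rfl⟩

end History

namespace Criterion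

variable {M D : Type} {h : History M D} {S : Spec M D} {c : Criterion}

theorem Holds.exists_explained (H : c.Holds h S) : ∃ (co arb : h.Op → h.Op → Prop)
    (_ : IsStrictPO co) (harb : IsStrictPO arb), (∀ a b, h.po a b → co a b) ∧
      (∀ a b, co a b → arb a b) ∧ ∀ o, ∃ K, h.Explained S arb harb (h.causalPast co o) K := by
  cases c with
  | CC =>
    obtain ⟨co, hco, hpo, H⟩ := H
    exact ⟨co, co, hco, hco, hpo, fun _ _ => id, fun o => ⟨_, H o⟩⟩
  | CM =>
    obtain ⟨co, hco, hpo, H⟩ := H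
    exact ⟨co, co, hco, hco, hpo, fun _ _ => id, fun o => ⟨_, H o⟩⟩
  | CCv =>
    obtain ⟨co, arb, hco, harb, hpo, hca, H⟩ := H
    exact ⟨co, arb, hco, harb.1, hpo, hca, fun o => ⟨_, H o⟩⟩

theorem holds_of_explained {co arb : h.Op → h.Op → Prop} (hco : IsStrictPO co)
    (harb : IsStrictTO arb) (hpo : ∀ a b, h.po a b → co a b) (hca : ∀ a b, co a b → arb a b)
    (H : ∀ o K, h.Explained S arb harb.1 (h.causalPast co o) K) : c.Holds h S := by
  cases c with
  | CC => exact ⟨co, hco, hpo, fun o => (H o _).mono hca⟩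
  | CM => exact ⟨co, hco, hpo, fun o => (H o _).mono hca⟩
  | CCv => exact ⟨co, arb, hco, harb, hpo, hca, fun o => H o _⟩

open Classical in
theorem holds_of_enumeration {E : List h.Op} (hE : E.Nodup) (hmem : ∀ x, x ∈ E)
    {co : h.Op → h.Op → Prop} (hco : IsStrictPO co) (hpo : ∀ a b, h.po a b → co a b)
    (hca : ∀ a b, co a b → E.idxOf a < E.idxOf b)
    (H : ∀ o, (E.filter (· ∈ h.causalPast co o)).map h.label ∈ S) : c.Holds h S := by
  have harb : IsStrictTO fun a b => E.idxOf a < E.idxOf b := by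
    refine ⟨⟨fun a => lt_irrefl _, fun a b c => lt_trans⟩, fun a b hab => ?_⟩
    exact lt_or_gt_of_ne fun h => hab ((List.idxOf_inj (hmem a)).1 h)
  have hEr : E.Pairwise fun a b => E.idxOf a < E.idxOf b := by
    rw [List.pairwise_iff_getElem]
    intro i j hi hj hij
    rwa [hE.idxOf_getElem, hE.idxOf_getElem]
  refine holds_of_explained hco harb hpo hca fun o K => ?_
  exact History.explained_of_list (hE.filter _) (fun x => by simp [hmem]) (hEr.filter _) (H o) K

end Criterion

/-! ## Projections of enumerations -/

theorem proj_congr {v w : List (OpLabel ℕ ℕ)}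
    (h : v.map (fun a => (a.1, a.2.1)) = w.map fun a => (a.1, a.2.1)) (s r : ℕ) :
    proj s r v = proj s r w := by
  have : ∀ u : List (OpLabel ℕ ℕ), proj s r u =
      ((u.map fun a => (a.1, a.2.1)).filter fun b => b.1 = s && onTrack r b.2).map Prod.snd := by
    intro u
    rw [proj, List.filter_map, List.map_map]
    rfl
  rw [this, this, h]

theorem proj_map_filter {ι : Type} (l : ι → OpLabel ℕ ℕ) (s r : ℕ) {q : ι → Bool} {L : List ι}
    (h : ∀ x ∈ L, (l x).1 = s → onTrack r (l x).2.1 → q x) :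
    proj s r ((L.filter q).map l) = proj s r (L.map l) := by
  simp only [proj, List.filter_map, List.filter_filter]
  congr 2
  refine List.filter_congr fun x hx => ?_
  have := h x hx
  simp only [Function.comp_apply]
  by_cases h1 : (l x).1 = s
  · by_cases h2 : onTrack r (l x).2.1
    · simp [h1, h2, this h1 h2]
    · simp [h2]
  · simp [h1]

section Execution

variable {e : List (ExecLabel ℕ ℕ ℕ)}

theorem filter_eq_filter_finRange {E : List (Fin e.length)} (hE : E.Nodup) (hmem : ∀ x, x ∈ E)
    (hlt : E.Pairwise fun a b => (e.get a).1 = (e.get b).1 → a < b) (s : ℕ) :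
    E.filter (fun x => (e.get x).1 = s) =
      (List.finRange e.length).filter fun x => (e.get x).1 = s := by
  have hperm : E.Perm (List.finRange e.length) :=
    (List.perm_ext_iff_of_nodup hE (List.nodup_finRange _)).2 fun x => by simp [hmem]
  refine (hperm.filter _).eq_of_pairwise (le := (· < ·)) ?_ ?_ ?_
  · exact fun a b _ _ h h' => absurd h' (lt_asymm h)
  · rw [List.pairwise_filter]
    exact hlt.imp fun h h1 h2 => h (by simp_all)
  · exact (List.pairwise_lt_finRange _).filter _

theorem map_snd_get_finRange : (List.finRange e.length).map (fun i => (e.get i).2) =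
    e.map Prod.snd := by
  conv_rhs => rw [← List.map_get_finRange e, List.map_map]
  rfl

theorem proj_map_eq {E : List (Fin e.length)} (hE : E.Nodup) (hmem : ∀ x, x ∈ E)
    (hlt : E.Pairwise fun a b => (e.get a).1 = (e.get b).1 → a < b)
    (hsite : ∀ x, (e.get x).2.1 = (e.get x).1) (s r : ℕ) :
    proj s r (E.map fun i => (e.get i).2) = proj s r (e.map Prod.snd) := by
  rw [← map_snd_get_finRange, ← proj_map_filter (L := E) (q := fun x => (e.get x).1 = s),
    filter_eq_filter_finRange hE hmem hlt, proj_map_filter]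
  · exact fun x _ h _ => decide_eq_true ((hsite x).symm.trans h)
  · exact fun x _ h _ => decide_eq_true ((hsite x).symm.trans h)

theorem idxOf_lt_of_pairwise {ι : Type} [DecidableEq ι] {E : List ι} {R : ι → ι → Prop}
    (hR : E.Pairwise R) {a b : ι} (ha : a ∈ E) (hb : b ∈ E) (hab : a ≠ b) (h : ¬ R b a) :
    E.idxOf a < E.idxOf b := by
  by_contra hlt
  rcases lt_or_eq_of_le (not_lt.1 hlt) with h' | h'
  · have := List.pairwise_iff_getElem.1 hR _ _ (List.idxOf_lt_length_iff.2 hb)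
      (List.idxOf_lt_length_iff.2 ha) h'
    rw [List.getElem_idxOf, List.getElem_idxOf] at this
    exact h this
  · exact hab ((List.idxOf_inj hb).1 h').symm

theorem idxOf_lt_idxOf_append {ι : Type} [DecidableEq ι] {w : List ι} {a z : ι} (ha : a ∈ w)
    (hz : z ∉ w) : (w ++ [z]).idxOf a < (w ++ [z]).idxOf z := by
  rw [List.idxOf_append_of_mem ha, List.idxOf_append_of_notMem hz]
  exact Nat.lt_add_right _ (List.idxOf_lt_length_iff.2 ha)

variable {c : Criterion} {S : Spec ℕ ℕ} {R : ℕ} {Λ : List (OpLabel ℕ ℕ)}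

theorem holds_of_no_final (hS : ∀ w, w ∈ S ↔ w ∈ specLanguage R ∧ ∀ a ∈ w, a ∈ Λ)
    (hΛ : ∀ x ∈ e, x.2 ∈ Λ) (hfin : ∀ x ∈ e, ¬ (x.2.1 = 0 ∧ x.2.2.1 = 1)) :
    c.Holds (execHistory e) S := by
  classical
  refine Criterion.holds_of_enumeration (h := execHistory e) (E := List.finRange e.length)
    (List.nodup_finRange _) List.mem_finRange (execHistory e).po_strict (fun _ _ => id) ?_ ?_
  · intro a b hab
    exact idxOf_lt_of_pairwise (ι := (execHistory e).Op)
      (R := fun a b : Fin e.length => a < b) (List.pairwise_lt_finRange _)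
      (List.mem_finRange _) (List.mem_finRange _) hab.2.ne (lt_asymm hab.2)
  · intro o
    refine (hS _).2 ⟨Or.inl ?_, ?_⟩
    · intro a ha
      obtain ⟨x, _, rfl⟩ := List.mem_map.1 ha
      exact hfin _ (List.get_mem e x)
    · intro a ha
      obtain ⟨x, _, rfl⟩ := List.mem_map.1 ha
      exact hΛ _ (List.get_mem e x)

theorem exists_proj_ne_of_holds (hS : ∀ w ∈ S, w ∈ specLanguage R)
    (hsite : ∀ x : Fin e.length, (e.get x).2.1 = (e.get x).1)
    (h01 : ∀ x : Fin e.length, (e.get x).1 = 0 ∨ (e.get x).1 = 1)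
    {m z : Fin e.length} (hz0 : (e.get z).1 = 0) (hz1 : (e.get z).2.2.1 = 1) (hz : ∀ x, x ≤ z)
    (hm1 : (e.get m).1 = 1)
    (hm : ∀ x, (e.get x).1 = 1 → x ≤ m)
    (hm' : ∀ x, (e.get x).1 = 1 → (e.get x).2.2.1 = 0 → x = m)
    (H : c.Holds (execHistory e) S) :
    ∃ r < R, proj 0 r (e.map Prod.snd) ≠ proj 1 r (e.map Prod.snd) := by
  obtain ⟨co, arb, hco, harb, hpo, hca, H⟩ := H.exists_explained
  obtain ⟨K, HK⟩ := H z
  obtain ⟨w, hw, E, hE, hmem, hpw, hmap⟩ := HK.exists_list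
  change E.map (fun x => ((e.get x).2.1, (e.get x).2.2.1)) = _ at hmap
  have hzE : z ∈ E := (hmem z).2 (Or.inr rfl)
  rcases hS w hw with h | ⟨⟨a, ha, ha1, ha0⟩, r, hr, hbad⟩
  · have : ((0 : ℕ), 1) ∈ w.map fun a => (a.1, a.2.1) := by
      rw [← hmap]
      exact List.mem_map.2 ⟨z, hzE, by rw [hsite, hz0, hz1]⟩
    obtain ⟨a, ha, ha'⟩ := List.mem_map.1 this
    exact absurd (by simpa using ha') (h a ha)
  · refine ⟨r, hr, ?_⟩
    have : ((1 : ℕ), 0) ∈ E.map (fun x => ((e.get x).2.1, (e.get x).2.2.1)) := by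
      rw [hmap]
      exact List.mem_map.2 ⟨a, ha, by rw [ha1, ha0]⟩
    obtain ⟨x, hx, hx'⟩ := List.mem_map.1 this
    obtain ⟨hx1, hx0⟩ := Prod.mk.inj hx'
    rw [hsite] at hx1
    obtain rfl := hm' x hx1 hx0
    have hxz : co x z ∨ x = z := (hmem x).1 hx
    have hall : ∀ y, y ∈ E := by
      intro y
      refine (hmem y).2 ?_
      rcases h01 y with h0 | h1
      · by_cases hy : y = z
        · exact Or.inr hy
        · exact Or.inl (hpo _ _ ⟨h0.trans hz0.symm, lt_of_le_of_ne (hz y) hy⟩)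
      · by_cases hy : y = x
        · exact hy ▸ hxz
        · have hyx : co y x := hpo _ _ ⟨h1.trans hm1.symm, lt_of_le_of_ne (hm y h1) hy⟩
          rcases hxz with h | h
          · exact Or.inl (hco.2 _ _ _ hyx h)
          · exact Or.inl (h ▸ hyx)
    have hlt : E.Pairwise fun a b => (e.get a).1 = (e.get b).1 → a < b := by
      refine (hpw.and hE).imp ?_
      rintro a b ⟨h1, h2⟩ hab
      refine lt_of_le_of_ne (not_lt.1 fun hba => h1 (hca _ _ (hpo _ _ ⟨hab.symm, hba⟩))) h2
    have hproj : ∀ s, proj s r w = proj s r (e.map Prod.snd) := by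
      intro s
      rw [← proj_map_eq hE hall hlt hsite]
      refine proj_congr ?_ s r
      rw [← hmap]
      exact (List.map_map (f := fun i : Fin e.length => (e.get i).2)
        (g := fun a : OpLabel ℕ ℕ => (a.1, a.2.1)) (l := E)).symm
    rw [← hproj, ← hproj]
    exact Det.proj_ne_of_foldl_eq_bad.1 hbad

theorem holds_of_not_prefix (hS : ∀ w, w ∈ S ↔ w ∈ specLanguage R ∧ ∀ a ∈ w, a ∈ Λ)
    (hΛ : ∀ x ∈ e, x.2 ∈ Λ)
    (hsite : ∀ x : Fin e.length, (e.get x).2.1 = (e.get x).1)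
    (h01 : ∀ x : Fin e.length, (e.get x).1 = 0 ∨ (e.get x).1 = 1)
    {m z : Fin e.length} (hz0 : (e.get z).1 = 0) (hz1 : (e.get z).2.2.1 = 1) (hz : ∀ x, x ≤ z)
    (hz' : ∀ x, (e.get x).1 = 0 → (e.get x).2.2.1 = 1 → x = z)
    (hm1 : (e.get m).1 = 1) (hm0 : (e.get m).2.2.1 = 0) {r : ℕ} (hr : r < R)
    (h : ¬ proj 0 r (e.map Prod.snd) <+: proj 1 r (e.map Prod.snd))
    (h' : ¬ proj 1 r (e.map Prod.snd) <+: proj 0 r (e.map Prod.snd)) :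
    c.Holds (execHistory e) S := by
  classical
  let l : Fin e.length → OpLabel ℕ ℕ := fun x => (e.get x).2
  let U := (List.finRange e.length).filter fun x => (e.get x).1 = 0 && x ≠ z
  let V := (List.finRange e.length).filter fun x => (e.get x).1 = 1
  have hU : proj 0 r (U.map l) = proj 0 r (e.map Prod.snd) := by
    rw [← map_snd_get_finRange]
    refine proj_map_filter l 0 r fun x _ hx hx' => ?_
    have : x ≠ z := by
      rintro rfl
      simp only [l, hz1, onTrack] at hx'
      simp at hx'
    simpa [this] using (hsite x).symm.trans hx
  have hV : proj 1 r (V.map l) = proj 1 r (e.map Prod.snd) := by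
    rw [← map_snd_get_finRange]
    refine proj_map_filter l 1 r fun x _ hx _ => ?_
    exact decide_eq_true ((hsite x).symm.trans hx)
  have memU : ∀ x, x ∈ U ↔ (e.get x).1 = 0 ∧ x ≠ z := fun x => by simp [U]
  have memV : ∀ x, x ∈ V ↔ (e.get x).1 = 1 := fun x => by simp [V]
  obtain ⟨w, hw0, hw1, hw, hbad⟩ := Det.exists_interleaving l r U V
    (fun x hx => (hsite x).trans ((memU x).1 hx).1) (fun x hx => (hsite x).trans ((memV x).1 hx))
    (by rwa [hU, hV]) (by rwa [hU, hV])
  have hzw : z ∉ w := by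
    intro hzw
    rcases hw z hzw with h | h
    · exact ((memU z).1 h).2 rfl
    · have := (memV z).1 h
      omega
  have hmemw : ∀ x, x ≠ z → x ∈ w := by
    intro x hx
    rcases h01 x with h0 | h1
    · have : x ∈ U := (memU x).2 ⟨h0, hx⟩
      rw [← hw0] at this
      exact (List.mem_filter.1 this).1
    · have : x ∈ V := (memV x).2 h1
      rw [← hw1] at this
      exact (List.mem_filter.1 this).1
  have hnd : w.Nodup := by
    rw [List.nodup_iff_count_le_one]
    intro x
    rcases h01 x with h0 | h1
    · rw [← List.count_filter (p := fun x => (l x).1 = 0)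
        (decide_eq_true ((hsite x).trans h0)), hw0]
      exact List.nodup_iff_count_le_one.1 ((List.nodup_finRange _).filter _) x
    · rw [← List.count_filter (p := fun x => (l x).1 = 1)
        (decide_eq_true ((hsite x).trans h1)), hw1]
      exact List.nodup_iff_count_le_one.1 ((List.nodup_finRange _).filter _) x
  have hpw : w.Pairwise fun a b => (e.get a).1 = (e.get b).1 → a < b := by
    have p0 : (w.filter (fun x => (l x).1 = 0)).Pairwise (· < ·) :=
      hw0 ▸ (List.pairwise_lt_finRange _).filter _
    have p1 : (w.filter (fun x => (l x).1 = 1)).Pairwise (· < ·) :=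
      hw1 ▸ (List.pairwise_lt_finRange _).filter _
    rw [List.pairwise_filter] at p0 p1
    refine (p0.and p1).imp ?_
    rintro a b ⟨q0, q1⟩ hab
    rcases h01 a with ha | ha
    · exact q0 (decide_eq_true ((hsite a).trans ha))
        (decide_eq_true ((hsite b).trans (hab.symm.trans ha)))
    · exact q1 (decide_eq_true ((hsite a).trans ha))
        (decide_eq_true ((hsite b).trans (hab.symm.trans ha)))
  let E := w ++ [z]
  have hE : E.Nodup := by
    refine List.nodup_append.2 ⟨hnd, List.nodup_singleton z, ?_⟩
    intro a ha b hb
    rw [List.mem_singleton.1 hb]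
    rintro rfl
    exact hzw ha
  have hmem : ∀ x, x ∈ E := by
    intro x
    by_cases hx : x = z
    · simp [E, hx]
    · simp [E, hmemw x hx]
  have hlt : ∀ x, x ≠ z → x < z := fun x hx => lt_of_le_of_ne (hz x) hx
  have hEpw : E.Pairwise fun a b => (e.get a).1 = (e.get b).1 → a < b := by
    refine List.pairwise_append.2 ⟨hpw, List.pairwise_singleton _ _, ?_⟩
    intro a ha b hb _
    rw [List.mem_singleton.1 hb]
    exact hlt a fun h => hzw (h ▸ ha)
  let co : Fin e.length → Fin e.length → Prop := fun x y =>
    (execHistory e).po x y ∨ (y = z ∧ x ≠ z)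
  have hco : IsStrictPO co := by
    constructor
    · rintro a (h | ⟨h, h'⟩)
      exacts [(execHistory e).po_strict.1 a h, h' h]
    · rintro a b c (h | ⟨rfl, h'⟩) (h2 | ⟨rfl, h2'⟩)
      · exact Or.inl ((execHistory e).po_strict.2 _ _ _ h h2)
      · refine Or.inr ⟨rfl, ?_⟩
        rintro rfl
        exact absurd (hz b) (not_le.2 h.2)
      · exact absurd (hz c) (not_le.2 h2.2)
      · exact absurd rfl h2'
  refine Criterion.holds_of_enumeration (h := execHistory e) (E := E) hE hmem (co := co) hco
    (fun _ _ => Or.inl) ?_ ?_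
  · rintro a b (hab | ⟨rfl, hab⟩)
    · exact idxOf_lt_of_pairwise (ι := (execHistory e).Op) hEpw (hmem a) (hmem b) hab.2.ne
        fun h => lt_asymm hab.2 (h hab.1.symm)
    · exact idxOf_lt_idxOf_append (ι := (execHistory e).Op) (hmemw a hab) hzw
  · intro o
    refine (hS _).2 ⟨?_, ?_⟩
    · by_cases ho : o = z
      · subst ho
        have hall : List.filter (α := (execHistory e).Op)
            (fun x => x ∈ (execHistory e).causalPast co o) E = E := by
          refine List.filter_eq_self.2 fun x _ => decide_eq_true ?_
          by_cases hx : x = o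
          · exact Or.inr hx
          · exact Or.inl (Or.inr ⟨rfl, hx⟩)
        refine (congrArg (fun L => List.map (execHistory e).label L ∈ specLanguage R) hall).mpr
          (Or.inr ⟨⟨l m, List.mem_map.2 ⟨m, hmem m, rfl⟩, (hsite m).trans hm1, hm0⟩, r, hr, ?_⟩)
        change List.foldl _ _ (List.map l E) = _
        simp only [E, List.map_append, List.foldl_append, hbad, Det.foldl_bad]
      · left
        intro a ha
        obtain ⟨x, hx, rfl⟩ := List.mem_map.1 ha
        rintro ⟨ha0, ha1⟩
        have hx0 : (e.get x).1 = 0 := (hsite x).symm.trans ha0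
        obtain rfl := hz' x hx0 ha1
        rcases of_decide_eq_true (List.mem_filter.1 hx).2 with (h | ⟨h, _⟩) | h
        · exact absurd (hz o) (not_le.2 h.2)
        · exact ho h
        · exact ho h.symm
    · intro a ha
      obtain ⟨x, _, rfl⟩ := List.mem_map.1 ha
      exact hΛ _ (List.get_mem e x)

end Execution

/-! ## Undecidability -/

/-- The operation with a given label, on the site that the label names. -/
def onSite (a : OpLabel ℕ ℕ) : ExecLabel ℕ ℕ ℕ := (a.1, a)

/-- The operations that end an execution. -/
def ending : List (OpLabel ℕ ℕ) := [lbl 1 0, lbl 0 0, lbl 0 1]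

theorem map_snd_map_onSite (w : List (OpLabel ℕ ℕ)) : (w.map onSite).map Prod.snd = w := by
  rw [List.map_map]
  exact List.map_id w

theorem mem_flatMap_code {R : ℕ} {w : List Instr} (hw : ∀ i ∈ w, i.reg < R) {a : OpLabel ℕ ℕ}
    (ha : a ∈ w.flatMap Instr.code) :
    ∃ s k, a = lbl s k ∧ s < 2 ∧ 2 ≤ k ∧ k < 2 * R + 2 := by
  obtain ⟨i, hi, ha⟩ := List.mem_flatMap.1 ha
  have := hw i hi
  cases i <;> simp only [Instr.reg] at this <;> simp only [Instr.code, List.mem_cons,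
    List.not_mem_nil, or_false] at ha
  · exact ⟨_, _, ha, by omega, by omega, by omega⟩
  · exact ⟨_, _, ha, by omega, by omega, by omega⟩
  · rcases ha with ha | ha
    · exact ⟨_, _, ha, by omega, by omega, by omega⟩
    · exact ⟨_, _, ha, by omega, by omega, by omega⟩

theorem not_prefix_of_ne {u v : List ℕ} (hv : 0 ∉ v) (h : u ≠ v) :
    ¬ u ++ [0] <+: v ++ [0] := by
  rintro ⟨t, ht⟩
  rcases List.eq_nil_or_concat t with rfl | ⟨t, x, rfl⟩
  · rw [List.append_nil] at ht
    exact h (List.append_left_inj [0] |>.1 ht)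
  · rw [List.concat_eq_append, ← List.append_assoc] at ht
    have := (List.append_inj' ht rfl).1
    exact hv (this ▸ by simp)

/-- The letters of the operations of executions with counters below `R`. -/
def alphabet (R : ℕ) : List (OpLabel ℕ ℕ) :=
  (List.range 2).flatMap fun s => (List.range (2 * R + 2)).map (lbl s)

theorem lbl_mem_alphabet {R s k : ℕ} (hs : s < 2) (hk : k < 2 * R + 2) :
    lbl s k ∈ alphabet R :=
  List.mem_flatMap.2 ⟨s, List.mem_range.2 hs, List.mem_map.2 ⟨k, List.mem_range.2 hk, rfl⟩⟩

section Complete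

variable {c : Criterion} {S : Spec ℕ ℕ} {R : ℕ}

theorem mem_alphabet_of_mem {w : List Instr} (hw : ∀ i ∈ w, i.reg < R) {a : OpLabel ℕ ℕ}
    (ha : a ∈ w.flatMap Instr.code ++ ending) : a ∈ alphabet R := by
  rcases List.mem_append.1 ha with ha | ha
  · obtain ⟨s, k, rfl, hs, _, hk⟩ := mem_flatMap_code hw ha
    exact lbl_mem_alphabet hs hk
  · simp only [ending, List.mem_cons, List.not_mem_nil, or_false] at ha
    rcases ha with rfl | rfl | rfl <;> exact lbl_mem_alphabet (by omega) (by omega)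

/-- A complete execution satisfies the criterion if and only if its sites differ on a track. -/
theorem holds_complete_iff (hS : ∀ w, w ∈ S ↔ w ∈ specLanguage R ∧ ∀ a ∈ w, a ∈ alphabet R)
    {w : List Instr} (hw : ∀ i ∈ w, i.reg < R) :
    c.Holds (execHistory ((w.flatMap Instr.code ++ ending).map onSite)) S ↔
      ∃ r < R, proj 0 r (w.flatMap Instr.code) ≠ proj 1 r (w.flatMap Instr.code) := by
  set x := w.flatMap Instr.code with hx
  set e := (x ++ ending).map onSite with he
  have hx2 : ∀ a ∈ x, a.1 < 2 ∧ 2 ≤ a.2.1 := by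
    intro a ha
    obtain ⟨s, k, rfl, hs, hk, _⟩ := mem_flatMap_code hw ha
    exact ⟨hs, hk⟩
  have hlen : e.length = x.length + 3 := by simp [he, ending]
  have hget : ∀ i : Fin e.length, e.get i = onSite (e.get i).2 := by
    intro i
    obtain ⟨a, _, ha⟩ := List.mem_map.1 (List.get_mem e i)
    rw [← ha]
    rfl
  have hsite : ∀ i : Fin e.length, (e.get i).2.1 = (e.get i).1 := fun i =>
    (congrArg Prod.fst (hget i)).symm
  let m : Fin e.length := ⟨x.length, by omega⟩
  let z : Fin e.length := ⟨x.length + 2, by omega⟩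
  have hcases : ∀ i : Fin e.length, (i < m ∧ (e.get i).1 < 2 ∧ 2 ≤ (e.get i).2.2.1) ∨
      (i = m ∧ (e.get i).2 = lbl 1 0) ∨ ((e.get i).2 = lbl 0 0) ∨
      (i = z ∧ (e.get i).2 = lbl 0 1) := by
    intro i
    have h2 : ∀ h, e.get i = onSite ((x ++ ending)[(i : ℕ)]'h) := by
      intro h
      exact List.getElem_map onSite
    rcases lt_or_ge (i : ℕ) x.length with h | h
    · left
      rw [h2 (by simp; omega), List.getElem_append_left h]
      obtain ⟨h3, h4⟩ := hx2 _ (List.getElem_mem h)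
      exact ⟨h, h3, h4⟩
    · right
      rw [h2 (by have := i.2; simp [ending]; omega), List.getElem_append_right h]
      have hi := i.2
      obtain h' | h' | h' : (i : ℕ) = x.length ∨ (i : ℕ) = x.length + 1 ∨
        (i : ℕ) = x.length + 2 := by omega
      · exact Or.inl ⟨Fin.ext h', by simp [h', ending, onSite]⟩
      · exact Or.inr (Or.inl (by simp [h', ending, onSite]))
      · exact Or.inr (Or.inr ⟨Fin.ext h', by simp [h', ending, onSite]⟩)
  have hmget : (e.get m).2 = lbl 1 0 := by simp [he, m, ending, onSite]
  have hzget : (e.get z).2 = lbl 0 1 := by simp [he, z, ending, onSite]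
  have hm1 : (e.get m).1 = 1 := by rw [← hsite, hmget]; rfl
  have hz0 : (e.get z).1 = 0 := by rw [← hsite, hzget]; rfl
  have hmz : ∀ i : Fin e.length, i ≤ z := by
    intro i
    have := i.2
    change (i : ℕ) ≤ x.length + 2
    omega
  have h01 : ∀ i : Fin e.length, (e.get i).1 = 0 ∨ (e.get i).1 = 1 := by
    intro i
    rw [← hsite]
    rcases hcases i with ⟨_, h, _⟩ | ⟨_, h⟩ | h | ⟨_, h⟩
    · rw [← hsite] at h; omega
    · rw [h]; exact Or.inr rfl
    · rw [h]; exact Or.inl rfl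
    · rw [h]; exact Or.inl rfl
  have hproj : ∀ s r, s < 2 → proj s r (e.map Prod.snd) = proj s r x ++ [0] := by
    intro s r hs
    rw [he, map_snd_map_onSite, proj_append]
    congr 1
    obtain rfl | rfl : s = 0 ∨ s = 1 := by omega
    · simp [proj, ending, lbl, onTrack]
    · simp [proj, ending, lbl, onTrack]
  have h0 : ∀ s r, 0 ∉ proj s r x := by
    intro s r h
    obtain ⟨a, ha, ha0⟩ := List.mem_map.1 h
    have := (hx2 a (List.mem_filter.1 ha).1).2
    omega
  constructor
  · intro H
    have hle : ∀ i, (e.get i).1 = 1 → i ≤ m := by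
      intro i hi
      rcases hcases i with ⟨h, _⟩ | ⟨h, _⟩ | h | ⟨_, h⟩
      · exact h.le
      · exact h.le
      · rw [← hsite, h] at hi; cases hi
      · rw [← hsite, h] at hi; cases hi
    have heq : ∀ i, (e.get i).1 = 1 → (e.get i).2.2.1 = 0 → i = m := by
      intro i hi hi'
      rcases hcases i with ⟨_, _, h⟩ | ⟨h, _⟩ | h | ⟨_, h⟩
      · omega
      · exact h
      · rw [← hsite, h] at hi; cases hi
      · rw [← hsite, h] at hi; cases hi
    obtain ⟨r, hr, h⟩ := exists_proj_ne_of_holds (m := m) (z := z)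
      (fun w hw => ((hS w).1 hw).1) hsite h01 hz0 (by rw [hzget]; rfl) hmz hm1 hle heq H
    refine ⟨r, hr, ?_⟩
    rw [hproj _ _ (by omega), hproj _ _ (by omega)] at h
    exact fun h' => h (by rw [h'])
  · rintro ⟨r, hr, h⟩
    refine holds_of_not_prefix (m := m) (z := z) hS ?_ hsite h01 hz0 (by rw [hzget]; rfl) hmz ?_
      hm1 (by rw [hmget]; rfl) hr ?_ ?_
    · intro b hb
      obtain ⟨a, ha, rfl⟩ := List.mem_map.1 hb
      exact mem_alphabet_of_mem hw ha
    · intro i _ hi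
      rcases hcases i with ⟨_, _, h⟩ | ⟨_, h⟩ | h | ⟨h, _⟩
      · omega
      · rw [h] at hi; cases hi
      · rw [h] at hi; cases hi
      · exact h
    · rw [hproj _ _ (by omega), hproj _ _ (by omega)]
      exact not_prefix_of_ne (h0 _ _) h
    · rw [hproj _ _ (by omega), hproj _ _ (by omega)]
      exact not_prefix_of_ne (h0 _ _) h.symm

/-- An incomplete execution satisfies the criterion. -/
theorem holds_of_prefix (hS : ∀ w, w ∈ S ↔ w ∈ specLanguage R ∧ ∀ a ∈ w, a ∈ alphabet R)
    {w : List Instr} (hw : ∀ i ∈ w, i.reg < R) {e : List (ExecLabel ℕ ℕ ℕ)}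
    (he : e <+: (w.flatMap Instr.code ++ ending).map onSite)
    (hne : e ≠ (w.flatMap Instr.code ++ ending).map onSite) : c.Holds (execHistory e) S := by
  refine holds_of_no_final hS ?_ ?_
  · intro b hb
    obtain ⟨a, ha, rfl⟩ := List.mem_map.1 (he.subset hb)
    exact mem_alphabet_of_mem hw ha
  · have : e <+: (w.flatMap Instr.code ++ [lbl 1 0, lbl 0 0]).map onSite := by
      have h : (w.flatMap Instr.code ++ ending).map onSite =
          (w.flatMap Instr.code ++ [lbl 1 0, lbl 0 0]).map onSite ++ [onSite (lbl 0 1)] := by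
        simp [ending]
      rw [h] at he hne
      exact (List.prefix_concat_iff.1 he).resolve_left hne
    intro b hb
    obtain ⟨a, ha, rfl⟩ := List.mem_map.1 (this.subset hb)
    rintro ⟨ha0, ha1⟩
    rcases List.mem_append.1 ha with ha | ha
    · obtain ⟨s, k, rfl, _, hk, _⟩ := mem_flatMap_code hw ha
      have : k = 1 := ha1
      omega
    · simp only [List.mem_cons, List.not_mem_nil, or_false] at ha
      rcases ha with rfl | rfl <;> cases ha1

end Complete

/-- The halting problem reduces to the failure of any of the criteria, on two sites. -/
theorem exists_reduction {f : ℕ →. ℕ} (hf : Nat.Partrec f) : ∃ g : ℕ → Input, Computable g ∧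
    ∀ n, ValidInput (g n) ∧ TwoSites (g n) ∧ ∀ c, AllExecutions c (g n) ↔ ¬ (f n).Dom := by
  obtain ⟨P, hP⟩ := exists_prog_proj_eq_iff_dom hf
  obtain ⟨R₀, hR₀⟩ := P.exists_reg_lt
  let R := R₀ + 1
  have hreg : ∀ n, ∀ w ∈ P.words, ∀ i ∈ List.replicate n (Instr.inc 0) ++ w, i.reg < R := by
    intro n w hw i hi
    rcases List.mem_append.1 hi with hi | hi
    · rw [List.eq_of_mem_replicate hi]
      exact Nat.succ_pos _
    · exact Nat.lt_succ_of_lt (hR₀ w hw i hi)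
  obtain ⟨𝒮, h𝒮⟩ := FinAutomaton.exists_language_eq (specLanguage_isRegular R) (alphabet R)
  have hS : ∀ w, w ∈ 𝒮.language ↔ w ∈ specLanguage R ∧ ∀ a ∈ w, a ∈ alphabet R := by
    intro w
    rw [h𝒮]
    rfl
  let L : Language (ExecLabel ℕ ℕ ℕ) :=
    P.words.subst (fun i => i.code.map onSite) * {ending.map onSite}
  have hL : ∀ y, y ∈ L ↔ ∃ w ∈ P.words, y = (w.flatMap Instr.code ++ ending).map onSite := by
    intro y
    constructor
    · rintro ⟨_, ⟨w, hw, rfl⟩, _, rfl, rfl⟩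
      exact ⟨w, hw, by simp [List.map_flatMap]⟩
    · rintro ⟨w, hw, rfl⟩
      exact ⟨_, ⟨w, hw, rfl⟩, _, rfl, by simp [List.map_flatMap]⟩
  obtain ⟨w₀, hw₀⟩ := P.exists_mem_words
  obtain ⟨g, hg, hgL⟩ := FinAutomaton.exists_computable_language_prefixes (L := L)
    ((P.isRegular_subst_words _).mul (Language.isRegular_singleton _))
    ⟨_, (hL _).2 ⟨w₀, hw₀, rfl⟩⟩ (Λ := (alphabet R).map onSite) (by
      intro y hy b hb
      obtain ⟨w, hw, rfl⟩ := (hL y).1 hy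
      obtain ⟨a, ha, rfl⟩ := List.mem_map.1 hb
      exact List.mem_map.2 ⟨a, mem_alphabet_of_mem (hreg 0 w hw) ha, rfl⟩) (onSite (lbl 0 2))
  have hmem : ∀ n e, e ∈ (g n).language ↔ ∃ w ∈ P.words,
      e <+: ((List.replicate n (Instr.inc 0) ++ w).flatMap Instr.code ++ ending).map onSite := by
    intro n e
    rw [hgL]
    have : ∀ w : List Instr, ((List.replicate n (Instr.inc 0) ++ w).flatMap Instr.code ++
        ending).map onSite = List.replicate n (onSite (lbl 0 2)) ++
          (w.flatMap Instr.code ++ ending).map onSite := by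
      intro w
      have : (List.replicate n (Instr.inc 0)).flatMap Instr.code =
          List.replicate n (lbl 0 2) := by
        induction n with
        | zero => rfl
        | succ n ih => rw [List.replicate_succ, List.flatMap_cons, ih]; rfl
      simp [this]
    constructor
    · rintro ⟨y, hy, h⟩
      obtain ⟨w, hw, rfl⟩ := (hL y).1 hy
      exact ⟨w, hw, by rwa [this]⟩
    · rintro ⟨w, hw, h⟩
      exact ⟨_, (hL _).2 ⟨w, hw, rfl⟩, by rwa [← this]⟩
  refine ⟨fun n => (g n, 𝒮), hg.pair (Computable.const 𝒮), fun n => ⟨?_, ?_, fun c => ?_⟩⟩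
  · intro e₁ e₂ he
    obtain ⟨w, hw, h⟩ := (hmem n _).1 he
    exact (hmem n _).2 ⟨w, hw, (List.prefix_append _ _).trans h⟩
  · intro e he b hb
    obtain ⟨w, hw, h⟩ := (hmem n _).1 he
    obtain ⟨a, ha, rfl⟩ := List.mem_map.1 (h.subset hb)
    have := mem_alphabet_of_mem (hreg n w hw) ha
    simp only [alphabet, List.mem_flatMap, List.mem_map, List.mem_range] at this
    obtain ⟨s, hs, k, _, rfl⟩ := this
    change s = 0 ∨ s = 1
    omega
  · rw [hP]
    constructor
    · rintro H ⟨w, hw, h⟩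
      obtain ⟨r, _, hr⟩ := (holds_complete_iff hS (hreg n w hw)).1
        (H _ ((hmem n _).2 ⟨w, hw, List.prefix_refl _⟩))
      exact hr (h r)
    · intro H e he
      obtain ⟨w, hw, h⟩ := (hmem n _).1 he
      by_cases hne : e = ((List.replicate n (Instr.inc 0) ++ w).flatMap Instr.code ++
        ending).map onSite
      · rw [hne]
        refine (holds_complete_iff hS (hreg n w hw)).2 ?_
        by_contra hr
        push Not at hr
        refine H ⟨w, hw, fun r => ?_⟩
        by_cases hrR : r < R
        · exact hr r hrR
        · have : ∀ s, proj s r ((List.replicate n (Instr.inc 0) ++ w).flatMap Instr.code) =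
              [] := by
            intro s
            simp only [proj, List.map_eq_nil_iff, List.filter_eq_nil_iff]
            intro a ha
            obtain ⟨s, k, rfl, _, hk, hk'⟩ := mem_flatMap_code (hreg n w hw) ha
            have hr : onTrack r k = false := by
              simp [onTrack]
              omega
            simp [lbl, hr]
          rw [this, this]
      · exact holds_of_prefix hS (hreg n w hw) h hne

theorem not_decidableOn_allExecutions (c : Criterion) {V : Input → Prop}
    (hV : ∀ x, ValidInput x → TwoSites x → V x) : ¬ DecidableOn V (AllExecutions c) := by
  rintro ⟨F, hF, hFV⟩
  let f : ℕ →. ℕ := fun n => (Denumerable.ofNat Nat.Partrec.Code n).eval 0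
  have hf : Nat.Partrec f := by
    rw [← Partrec.nat_iff]
    exact Nat.Partrec.Code.eval_part.comp (Computable.ofNat Nat.Partrec.Code)
      (Computable.const 0)
  obtain ⟨g, hg, H⟩ := exists_reduction hf
  refine ComputablePred.halting_problem 0 ?_
  classical
  refine ⟨fun _ => Classical.propDecidable _, ?_⟩
  have h : Partrec fun code : Nat.Partrec.Code =>
      (F (g (Encodable.encode code))).map fun b => !b :=
    (hF.comp (hg.comp Computable.encode)).map (Primrec.not.to_comp.comp Computable.snd)
  refine h.of_eq fun code => ?_
  obtain ⟨h1, h2, h3⟩ := H (Encodable.encode code)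
  obtain ⟨b, hb, hb'⟩ := hFV _ (hV _ h1 h2)
  rw [h3 c] at hb'
  simp only [f, Denumerable.ofNat_encode] at hb'
  rw [Part.eq_some_iff.2 hb, Part.map_some]
  change Part.some _ = Part.some _
  congr 1
  cases b <;> simp_all

theorem mainTheorem6 (c : Criterion) :
    ¬ DecidableOn ValidInput (AllExecutions c) ∧
    ¬ DecidableOn (fun x => ValidInput x ∧ TwoSites x) (AllExecutions c) :=
  ⟨not_decidableOn_allExecutions c fun _ h _ => h,
    not_decidableOn_allExecutions c fun _ h h' => ⟨h, h'⟩⟩
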